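/- Let $\Upsilon=(X,U,f)$ be a discrete-time deterministic control system: $X\subseteq\mathbb R^n$, $U\subset\mathbb R^p$ finite, $f:X\times U\to X$ measurable (and unknown). Let $X$ be partitioned into finitely many nonempty cells with a representative point chosen in each, let $\hat X$ be the finite set of representatives, let $\mathcal Q:X\to\hat X$ map a state to the representative of its cell, and let $\hat\Upsilon=(\hat X,U,\hat f)$ with $\hat f(\hat x,\nu)=\mathcal Q(f(\hat x,\nu))$ be the symbolic model. A function $\mathcal V:X\times\hat X\to[0,\infty)$ is an alternating bisimulation function (ABF) between $\hat\Upsilon$ and $\Upsilon$ if there are $\sigma>0$, $0<\gamma<1$, $\rho\ge 0$ such that, for all $x\in X$, $\hat x\in\hat X$, $\nu\in U$, $\sigma\|x-\hat x\|^2\le\mathcal V(x,\hat x)$ and $\mathcal V(f(x,\nu),\hat f(\hat x,\nu))\le\max\{\gamma\mathcal V(x,\hat x),\rho\}$, where $\|\cdot\|$ is the Euclidean norm. Fix functions $q_1,\dots,q_z:X\times\hat X\to\mathbb R$ and put $\mathcal V(\eta,x,\hat x)=\sum_{j=1}^z\eta_jq_j(x,\hat x)$. Fix $\tilde\gamma_1,\dots,\tilde\gamma_l\in(0,1)$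 and a closed convex set $\Theta\subseteq\mathbb R^{z+2}$ of a-priori constraints on the parameters ($\Theta=\mathbb R^{z+2}$ is allowed). Call $\Psi=(\sigma,\tilde\rho,\eta)$ admissible if $\Psi\in\Theta$, $\sigma>0$ and $\tilde\rho\ge0$, and let $$\phi_1=\sigma\|x-\hat x\|^2-\mathcal V(\eta,x,\hat x),\qquad \phi_{2,k}=\mathcal V(\eta,f(x,\nu),\hat f(\hat x,\nu))-\tilde\gamma_k\mathcal V(\eta,x,\hat x)-\tilde\rho .$$ Assume that, for all $\hat x\in\hat X$, $\nu\in U$ and all admissible $\Psi$, $\phi_1$ is Lipschitz in $x\in X$ with constant $\mathcal I_1$ and $\phi_{2,k}$ is Lipschitz in $x\in X$ with constant $\mathcal I_{2_k}$, $k=1,\dots,l$. Put $\mathcal I_{\phi_k}=\max\{\mathcal I_1,\mathcal I_{2_k}\}$, let $\varepsilon_k\in[0,1]$ with $\varepsilon_k\le\mathcal I_{\phi_k}$, $\bar\varepsilon_k=(\varepsilon_k/\mathcal I_{\phi_k})^n$, and let $\mathbb P$ be a probability measure on $X$ such that $\mathbb P\{y\in X:\|y-x\|\le\varepsilon_k/\mathcal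 I_{\phi_k}\}\ge\bar\varepsilon_k$ for all $x\in X$ and all $k$. For i.i.d. samples $x_1,\dots,x_{\mathcal N}$ from $\mathbb P$, the scenario program minimizes $\mu\in\mathbb R$ over $k\in\{1,\dots,l\}$, admissible $\Psi$ and $\mu$, subject to $\max\{\phi_1,\phi_{2,k}\}\le\mu$ at $x=x_i$ for all $i\le\mathcal N$, $\hat x\in\hat X$, $\nu\in U$. Its number of continuous decision variables $(\sigma,\tilde\rho,\eta,\mu)$ is $r=z+3$. If the optimal solutions with a given $k$ are not unique, ties are broken by minimizing a fixed convex function $\tau$ of $\Psi$ (for instance a strictly convex function, or a constant if no tie-breaking is needed); the program is said to return a solution $(k,\Psi^*,\mu^*_{\mathcal N})$ if this is an optimal solution that minimizes $\tau$ among the optimal solutions with the same $k$, and all such minimizers determine the same function $\mathcal V^*=\mathcal V(\eta^*,\cdot,\cdot)$. Let $\beta\in[0,1]$, let $$\bar{\mathcal N}=\min\Big\{M\in\mathbb N:\ \sum_{k=1}^l\sum_{i=0}^{r-1}\binom Mi\bar\varepsilon_k^{\,i}(1-\bar\varepsilon_k)^{M-i}\le\beta\Big\}$$ (assuming that the set is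 nonempty), and let $\mathcal N\ge\bar{\mathcal N}$. Then, with $\mathbb P^{\mathcal N}$-probability at least $1-\beta$, the following holds: for every solution returned by the scenario program with $\mu^*_{\mathcal N}+\max_k\varepsilon_k\le0$, the function $\mathcal V^*$ is an ABF between $\hat\Upsilon$ and $\Upsilon$. -/

import Mathlib

open MeasureTheory
open scoped NNReal ENNReal

noncomputable section

/-- Euclidean space `ℝ^d` (with the Euclidean norm). -/
abbrev EVec (d : ℕ) : Type := EuclideanSpace ℝ (Fin d)

/-- A discrete-time deterministic control system `(X, U, f)`: a state set `X ⊆ ℝ^n`, a finite input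
set `U ⊆ ℝ^p` and a measurable transition map `f : X × U → X`. -/
structure DtDCS (n p : ℕ) where
  X : Set (EVec n)
  U : Finset (EVec p)
  f : X → U → X
  measurable_f : Measurable (Function.uncurry f)

/-- A finite partition of the state set into nonempty cells `X_i = {x | index x = i}`, with one
representative point chosen in every cell. -/
structure StatePartition {n : ℕ} (X : Set (EVec n)) where
  card : ℕ
  index : X → Fin card
  rep : Fin card → X
  index_rep : ∀ i, index (rep i) = i

namespace StatePartition

variable {n : ℕ} {X : Set (EVec n)} (π : StatePartition X)

/-- The finite set of abstract states: the representative points. -/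
def absStates : Set X := Set.range π.rep

/-- The map sending a state to the representative point of its cell. -/
def quantize (x : X) : π.absStates := ⟨π.rep (π.index x), Set.mem_range_self _⟩

/-- The state discretization parameter: the supremum of the distances inside the cells. -/
def delta : ℝ := sSup {d : ℝ | ∃ x x' : X, π.index x = π.index x' ∧ d = ‖(x : EVec n) - x'‖}

theorem norm_quantize_sub_le (hX : Bornology.IsBounded X) (x : X) :
    ‖((π.quantize x : X) : EVec n) - x‖ ≤ π.delta := by
  refine le_csSup ?_ ⟨(π.quantize x : X), x, π.index_rep _, rfl⟩
  obtain ⟨C, hC⟩ := Metric.isBounded_iff.1 hX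
  refine ⟨C, ?_⟩
  rintro d ⟨a, b, -, rfl⟩
  rw [← dist_eq_norm]
  exact hC a.2 b.2

end StatePartition

/-- The transition map of the symbolic model: quantize the successor of the abstract state. -/
def DtDCS.symb {n p : ℕ} (S : DtDCS n p) (π : StatePartition S.X)
    (xh : π.absStates) (ν : S.U) : π.absStates :=
  π.quantize (S.f xh ν)

/-- `V` is an alternating bisimulation function between the symbolic model and the system `S`. -/
def IsABF {n p : ℕ} (S : DtDCS n p) (π : StatePartition S.X)
    (V : S.X → π.absStates → ℝ) : Prop :=
  (∀ x xh, 0 ≤ V x xh) ∧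
  ∃ σ γ ρ : ℝ, 0 < σ ∧ 0 < γ ∧ γ < 1 ∧ 0 ≤ ρ ∧
    (∀ (x : S.X) (xh : π.absStates),
      σ * ‖(x : EVec n) - ((xh : S.X) : EVec n)‖ ^ 2 ≤ V x xh) ∧
    (∀ (x : S.X) (xh : π.absStates) (ν : S.U),
      V (S.f x ν) (S.symb π xh ν) ≤ max (γ * V x xh) ρ)

/-- The continuous decision variables `Ψ = (σ, ρ̃, η)`. -/
abbrev Param (z : ℕ) : Type := ℝ × ℝ × (Fin z → ℝ)

namespace Param
variable {z : ℕ}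
def sig (Ψ : Param z) : ℝ := Ψ.1
def rho (Ψ : Param z) : ℝ := Ψ.2.1
def eta (Ψ : Param z) : Fin z → ℝ := Ψ.2.2
end Param

/-- The parametrized candidate `V(η, x, x̂) = ∑_j η_j q_j(x, x̂)`. -/
def candV {n p z : ℕ} (S : DtDCS n p) (π : StatePartition S.X)
    (q : Fin z → S.X → π.absStates → ℝ) (η : Fin z → ℝ)
    (x : S.X) (xh : π.absStates) : ℝ :=
  ∑ j, η j * q j x xh

/-- `φ₁ = σ ‖x - x̂‖² - V(η, x, x̂)`. -/
def phi1 {n p z : ℕ} (S : DtDCS n p) (π : StatePartition S.X)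
    (q : Fin z → S.X → π.absStates → ℝ) (Ψ : Param z)
    (x : S.X) (xh : π.absStates) : ℝ :=
  Ψ.sig * ‖(x : EVec n) - ((xh : S.X) : EVec n)‖ ^ 2 - candV S π q Ψ.eta x xh

/-- `φ₂ = V(η, f(x, ν), f̂(x̂, ν)) - γ̃ V(η, x, x̂) - ρ̃`. -/
def phi2 {n p z : ℕ} (S : DtDCS n p) (π : StatePartition S.X)
    (q : Fin z → S.X → π.absStates → ℝ) (g : ℝ) (Ψ : Param z)
    (x : S.X) (xh : π.absStates) (ν : S.U) : ℝ :=
  candV S π q Ψ.eta (S.f x ν) (S.symb π xh ν) - g * candV S π q Ψ.eta x xh - Ψ.rho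

/-- Admissible `Ψ`: `σ > 0`, `ρ̃ ≥ 0`, and the additional constraints `Ψ ∈ Θ` of the user. -/
def Admissible {z : ℕ} (Θ : Set (Param z)) (Ψ : Param z) : Prop :=
  Ψ ∈ Θ ∧ 0 < Ψ.sig ∧ 0 ≤ Ψ.rho

/-- `(Ψ, μ)` is feasible for the scenario program with samples `ω` and `γ̃ = g`. -/
def SOPFeasible {n p z N : ℕ} (S : DtDCS n p) (π : StatePartition S.X)
    (q : Fin z → S.X → π.absStates → ℝ) (Θ : Set (Param z)) (ω : Fin N → S.X)
    (g : ℝ) (Ψ : Param z) (μ : ℝ) : Prop :=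
  Admissible Θ Ψ ∧ ∀ (i : Fin N) (xh : π.absStates) (ν : S.U),
    max (phi1 S π q Ψ (ω i) xh) (phi2 S π q g Ψ (ω i) xh ν) ≤ μ

/-- `(γ̃_k, Ψ, μ)` is an optimal solution of the scenario program in which `γ̃` ranges over
`γ̃_1, …, γ̃_l`; in particular `μ` is its optimal value. -/
def SOPOptimal {n p z N l : ℕ} (S : DtDCS n p) (π : StatePartition S.X)
    (q : Fin z → S.X → π.absStates → ℝ) (Θ : Set (Param z)) (γt : Fin l → ℝ) (ω : Fin N → S.X)
    (k : Fin l) (Ψ : Param z) (μ : ℝ) : Prop :=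
  SOPFeasible S π q Θ ω (γt k) Ψ μ ∧
    ∀ (k' : Fin l) (Ψ' : Param z) (μ' : ℝ), SOPFeasible S π q Θ ω (γt k') Ψ' μ' → μ ≤ μ'

/-- Among the optimal solutions with the same `γ̃_k`, `Ψ` minimizes the tie-breaking function `τ`. -/
def SOPPreferred {n p z N l : ℕ} (S : DtDCS n p) (π : StatePartition S.X)
    (q : Fin z → S.X → π.absStates → ℝ) (Θ : Set (Param z)) (γt : Fin l → ℝ) (τ : Param z → ℝ)
    (ω : Fin N → S.X) (k : Fin l) (Ψ : Param z) (μ : ℝ) : Prop :=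
  SOPOptimal S π q Θ γt ω k Ψ μ ∧ ∀ Ψ', SOPOptimal S π q Θ γt ω k Ψ' μ → τ Ψ ≤ τ Ψ'

/-- `Ψ` is the solution returned by the scenario program: it is preferred, and the function `V`
that it determines is the same for all preferred solutions with this `γ̃_k`. -/
def SOPReturns {n p z N l : ℕ} (S : DtDCS n p) (π : StatePartition S.X)
    (q : Fin z → S.X → π.absStates → ℝ) (Θ : Set (Param z)) (γt : Fin l → ℝ) (τ : Param z → ℝ)
    (ω : Fin N → S.X) (k : Fin l) (Ψ : Param z) (μ : ℝ) : Prop :=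
  SOPPreferred S π q Θ γt τ ω k Ψ μ ∧
    ∀ Ψ', SOPPreferred S π q Θ γt τ ω k Ψ' μ → candV S π q Ψ'.eta = candV S π q Ψ.eta

/-- Number of continuous decision variables `σ, ρ̃, η_1, …, η_z, μ` of the scenario program. -/
def numDecision (z : ℕ) : ℕ := z + 3

/-- `∑_k ∑_{i < r} C(N, i) ε̄_k^i (1 - ε̄_k)^(N - i)`. -/
def confSum {l : ℕ} (r : ℕ) (e : Fin l → ℝ) (N : ℕ) : ℝ :=
  ∑ k, ∑ i ∈ Finset.range r, (N.choose i : ℝ) * e k ^ i * (1 - e k) ^ (N - i)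

end

/-! Say that `x` violates `(Ψ, μ)` if some `φ` exceeds `μ` at `x`. If the violation probability is
below `ε̄_k`, every ball of radius `ε_k / I_{φ_k}` contains a non-violating point, so the Lipschitz
bounds give `φ ≤ μ + ε_k ≤ 0` on all of `X`, and this yields an ABF (`isABF_of_violation_lt`). An
optimum with index `k` is also optimal for the convex program with `k` fixed. By a union bound over
`k` it remains to show that a large violation in that program has probability at most a binomial
tail.

The tail comes from an exact moment computation. Let `W` be the probability that a fresh point does
not violate the solution of `d` random points. If almost every sample of each size `M ≥ d` has
exactly one supporting `d`-subset, summing over all `d`-subsets gives `C(M, d) · E[W^(M-d)] = 1`.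
These moments determine the law of `W` on `[0, 1]`, that of the minimum of `d` uniform variables,
and integrating `w^(N-d)` over `w ≤ 1 - e` gives the tail (`measure_supportedOn_violation_le`).

For a strictly convex min-max program on a compact set, Helly's theorem bounds the size of a basis
by `dim + 1`. Independent uniform marks added to the constraints exclude ties almost surely, which
makes the basis unique; the same marks pad it to exactly `d` elements (`existsUnique_support`,
`ae_existsUnique_supportedOn`).

The actual program need not be strictly convex or compact. It is perturbed to `f + δ τ + δ² (κ +
mark)`, with `κ` strictly convex. As `δ → 0`, perturbed optima accumulate at optima preferred by `τ`
(`eventually_regularized_violation`). This controls the violation of some preferred solution only,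
which suffices because all of them determine the same `V*`. Compactness comes from exhausting the
admissible set by `Param.truncation`. -/

/-! ### Binomial tails and the beta integral -/

/-- The lower tail `P(Bin(N, e) < r)` of a binomial distribution. -/
noncomputable def binTail (r N : ℕ) (e : ℝ) : ℝ :=
  ∑ i ∈ Finset.range r, (N.choose i : ℝ) * e ^ i * (1 - e) ^ (N - i)

theorem binTail_nonneg (r N : ℕ) {e : ℝ} (h0 : 0 ≤ e) (h1 : e ≤ 1) : 0 ≤ binTail r N e := by
  have : 0 ≤ 1 - e := by linarith
  unfold binTail
  positivity

theorem continuous_binTail (r N : ℕ) : Continuous (binTail r N) := by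
  unfold binTail
  fun_prop

theorem binTail_eq_one {r N : ℕ} (h : N < r) (e : ℝ) : binTail r N e = 1 := by
  have key : binTail (N + 1) N e = 1 := by
    have := add_pow e (1 - e) N
    rw [add_sub_cancel, one_pow] at this
    rw [this, binTail]
    exact Finset.sum_congr rfl fun i _ => by ring
  rw [← key, binTail, binTail]
  symm
  apply Finset.sum_subset
  · intro i hi
    simp only [Finset.mem_range] at *
    omega
  · intro i _ hi
    simp only [Finset.mem_range, not_lt] at hi
    rw [Nat.choose_eq_zero_of_lt (by omega)]
    simp

theorem binTail_zero {r : ℕ} (hr : 0 < r) (N : ℕ) : binTail r N 0 = 1 := by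
  rw [binTail, Finset.sum_eq_single_of_mem 0 (by simpa using hr)]
  · simp
  · intro i _ hi
    simp [hi]

theorem binTail_succ (r N : ℕ) (e : ℝ) :
    binTail (r + 1) (N + 1) e = (1 - e) * binTail (r + 1) N e + e * binTail r N e := by
  unfold binTail
  rw [Finset.sum_range_succ', Finset.sum_range_succ' (n := r), mul_add, Finset.mul_sum,
    Finset.mul_sum]
  have h : ∀ i ∈ Finset.range r, ((N + 1).choose (i + 1) : ℝ) * e ^ (i + 1) *
      (1 - e) ^ (N + 1 - (i + 1)) = (1 - e) * ((N.choose (i + 1) : ℝ) * e ^ (i + 1) *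
      (1 - e) ^ (N - (i + 1))) + e * ((N.choose i : ℝ) * e ^ i * (1 - e) ^ (N - i)) := by
    intro i _
    rw [Nat.choose_succ_succ, Nat.add_sub_add_right]
    rcases Nat.lt_or_ge i N with hi | hi
    · obtain ⟨m, rfl⟩ := Nat.exists_eq_add_of_lt hi
      rw [show i + m + 1 - i = m + 1 by omega, show i + m + 1 - (i + 1) = m by omega]
      push_cast
      ring
    · rw [Nat.choose_eq_zero_of_lt (show N < i + 1 by omega)]
      push_cast
      ring
  rw [Finset.sum_congr rfl h, Finset.sum_add_distrib]
  simp only [Nat.choose_zero_right, pow_zero, Nat.sub_zero, pow_succ]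
  ring

theorem binTail_le_succ (r N : ℕ) {e : ℝ} (h0 : 0 ≤ e) (h1 : e ≤ 1) :
    binTail r N e ≤ binTail (r + 1) N e := by
  have : 0 ≤ 1 - e := by linarith
  unfold binTail
  rw [Finset.sum_range_succ]
  have : 0 ≤ (N.choose r : ℝ) * e ^ r * (1 - e) ^ (N - r) := by positivity
  linarith

/-- One more trial replaces the tail by a convex combination of itself and a smaller tail
(`binTail_succ`). -/
theorem binTail_antitone (r : ℕ) {e : ℝ} (h0 : 0 ≤ e) (h1 : e ≤ 1) :
    Antitone fun N => binTail r N e := by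
  refine antitone_nat_of_succ_le fun N => ?_
  cases r with
  | zero => simp [binTail]
  | succ r =>
    rw [binTail_succ]
    nlinarith [binTail_le_succ r N h0 h1]

/-- The derivative of the sum telescopes, so that only the boundary term at `d` survives. -/
theorem hasDerivAt_binTail (N : ℕ) : ∀ d ≤ N, ∀ v : ℝ,
    HasDerivAt (binTail d N) (-((d * N.choose d : ℕ) * v ^ (d - 1) * (1 - v) ^ (N - d))) v := by
  intro d
  induction d with
  | zero =>
    intro _ v
    have : binTail 0 N = fun _ => 0 := by ext; simp [binTail]
    rw [this]
    simpa using hasDerivAt_const v (0 : ℝ)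
  | succ d ih =>
    intro hd v
    have h1 := ih (by omega) v
    have h2 : HasDerivAt (fun v : ℝ => (N.choose d : ℝ) * v ^ d * (1 - v) ^ (N - d))
        ((N.choose d : ℝ) * (d * v ^ (d - 1)) * (1 - v) ^ (N - d) + (N.choose d : ℝ) * v ^ d *
          (((N - d : ℕ) : ℝ) * (1 - v) ^ (N - d - 1) * (-1))) v :=
      ((hasDerivAt_pow d v).const_mul _).mul
        (((hasDerivAt_id v).const_sub 1).pow (N - d))
    have h3 : binTail (d + 1) N =
        fun v => binTail d N v + (N.choose d : ℝ) * v ^ d * (1 - v) ^ (N - d) := by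
      ext v
      simp [binTail, Finset.sum_range_succ]
    rw [h3]
    refine (h1.add h2).congr_deriv ?_
    have h4 : ((d + 1) * N.choose (d + 1) : ℕ) = N.choose d * (N - d) := by
      rw [← Nat.choose_succ_right_eq, mul_comm]
    rw [Nat.cast_mul (d+1), ← Nat.cast_mul, h4, show N - (d + 1) = N - d - 1 by omega]
    push_cast
    ring

theorem integral_beta_density {d N : ℕ} (hdN : d ≤ N) (a : ℝ) :
    ∫ w in (0 : ℝ)..a, ((d * N.choose d : ℕ) : ℝ) * (1 - w) ^ (d - 1) * w ^ (N - d) =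
      binTail d N (1 - a) := by
  have h : ∀ w : ℝ, HasDerivAt (fun w => binTail d N (1 - w))
      (((d * N.choose d : ℕ) : ℝ) * (1 - w) ^ (d - 1) * w ^ (N - d)) w := by
    intro w
    have := (hasDerivAt_binTail N d hdN (1 - w)).comp w ((hasDerivAt_id w).const_sub 1)
    convert! this using 1
    simp
  rw [intervalIntegral.integral_eq_sub_of_hasDerivAt (fun w _ => h w)
    (Continuous.intervalIntegrable (by fun_prop) _ _)]
  -- Each summand has `i < d ≤ N`, hence carries a factor `0 ^ (N - i)` with positive exponent.
  have : binTail d N (1 - 0) = 0 := by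
    rw [sub_zero, binTail]
    refine Finset.sum_eq_zero fun i hi => ?_
    rw [Finset.mem_range] at hi
    simp [show N - i ≠ 0 by omega]
  rw [this, sub_zero]

/-! ### The moment problem on the unit interval -/

/-- The law on `[0, 1]` with density `d (1 - w)^(d-1)`. -/
noncomputable def minBeta (d : ℕ) : Measure unitInterval :=
  volume.withDensity fun w => ENNReal.ofReal (d * (1 - (w : ℝ)) ^ (d - 1))

theorem integral_minBeta (d : ℕ) (g : ℝ → ℝ) :
    ∫ w, g (w : ℝ) ∂(minBeta d) =
      ∫ w in Set.Icc (0 : ℝ) 1, d * (1 - w) ^ (d - 1) * g w := by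
  rw [minBeta, integral_withDensity_eq_integral_toReal_smul]
  · rw [← integral_subtype measurableSet_Icc]
    refine integral_congr_ae (.of_forall fun w => ?_)
    have : 0 ≤ 1 - (w : ℝ) := by linarith [w.2.2]
    simp only [smul_eq_mul]
    rw [ENNReal.toReal_ofReal (by positivity)]
  · exact Measurable.ennreal_ofReal (by fun_prop)
  · exact .of_forall fun w => ENNReal.ofReal_lt_top

instance (d : ℕ) : IsFiniteMeasure (minBeta d) := by
  refine isFiniteMeasure_withDensity_ofReal ?_
  refine (Continuous.integrable_of_hasCompactSupport (by fun_prop)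
    (HasCompactSupport.of_compactSpace _)).2

/-- Polynomials are dense in `C([0, 1])` by Weierstrass and integration is continuous in the sup
norm, so the moments fix all integrals of continuous functions. -/
theorem measure_eq_of_moments_unitInterval {μ ν : Measure unitInterval} [IsFiniteMeasure μ]
    [IsFiniteMeasure ν] (h : ∀ m : ℕ, ∫ w, (w : ℝ) ^ m ∂μ = ∫ w, (w : ℝ) ^ m ∂ν) : μ = ν := by
  have hint : ∀ (ρ : Measure unitInterval) [IsFiniteMeasure ρ] (f : C(unitInterval, ℝ)),
      Integrable f ρ := fun ρ _ f => f.continuous.integrable_of_hasCompactSupport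
        (HasCompactSupport.of_compactSpace _)
  have hc : ∀ (ρ : Measure unitInterval) [IsFiniteMeasure ρ],
      Continuous fun f : C(unitInterval, ℝ) => ∫ w, f w ∂ρ := by
    intro ρ _
    refine (continuous_integral.comp
      (ContinuousMap.toLp (E := ℝ) 1 ρ ℝ).continuous).congr fun f => ?_
    exact integral_congr_ae (ContinuousMap.coeFn_toLp ρ f)
  have hall : ∀ f : C(unitInterval, ℝ), ∫ w, f w ∂μ = ∫ w, f w ∂ν := by
    have hcl : IsClosed {f : C(unitInterval, ℝ) | ∫ w, f w ∂μ = ∫ w, f w ∂ν} :=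
      isClosed_eq (hc μ) (hc ν)
    have hsub : (polynomialFunctions unitInterval : Set C(unitInterval, ℝ)) ⊆
        {f : C(unitInterval, ℝ) | ∫ w, f w ∂μ = ∫ w, f w ∂ν} := by
      rw [polynomialFunctions_coe]
      rintro _ ⟨p, rfl⟩
      have he : ∀ (ρ : Measure unitInterval) [IsFiniteMeasure ρ],
          ∫ w, (p.toContinuousMapOnAlgHom unitInterval) w ∂ρ =
            ∑ i ∈ p.support, p.coeff i * ∫ w, (w : ℝ) ^ i ∂ρ := by
        intro ρ _
        simp only [Polynomial.toContinuousMapOnAlgHom_apply, Polynomial.toContinuousMapOn_apply,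
          Polynomial.toContinuousMap_apply, Polynomial.eval_eq_sum, Polynomial.sum]
        rw [integral_finsetSum]
        · exact Finset.sum_congr rfl fun i _ => integral_const_mul _ _
        · intro i _
          exact hint ρ ⟨fun w => p.coeff i * (w : ℝ) ^ i, by fun_prop⟩
      simp only [Set.mem_ofPred_eq] at *
      rw [he μ, he ν]
      exact Finset.sum_congr rfl fun i _ => by rw [h i]
    intro f
    have : f ∈ (polynomialFunctions unitInterval).topologicalClosure := by
      rw [polynomialFunctions_closure_eq_top']
      trivial
    exact closure_minimal hsub hcl this
  refine ext_of_forall_integral_eq_of_IsFiniteMeasure fun f => ?_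
  exact hall f.toContinuousMap

/-- A `[0, 1]`-valued variable with the moments of the minimum of `d` uniform variables. -/
theorem truncated_moment_of_moments {Ω : Type*} [MeasurableSpace Ω] (Q : Measure Ω)
    [IsProbabilityMeasure Q] {d : ℕ} (hd : 0 < d) (W : Ω → ℝ) (hW : Measurable W)
    (h0 : ∀ ω, 0 ≤ W ω) (h1 : ∀ ω, W ω ≤ 1)
    (hm : ∀ m : ℕ, ((m + d).choose d : ℝ) * ∫ ω, W ω ^ m ∂Q = 1)
    {N : ℕ} (hN : d ≤ N) {e : ℝ} (he0 : 0 ≤ e) (he1 : e ≤ 1) :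
    (N.choose d : ℝ) * ∫ ω, (Set.Iic (1 - e)).indicator (fun w => w ^ (N - d)) (W ω) ∂Q =
      binTail d N e := by
  let W' : Ω → unitInterval := fun ω => ⟨W ω, h0 ω, h1 ω⟩
  have hW' : Measurable W' := hW.subtype_mk
  have hlaw : Q.map W' = minBeta d := by
    have : IsProbabilityMeasure (Q.map W') := Measure.isProbabilityMeasure_map hW'.aemeasurable
    refine measure_eq_of_moments_unitInterval fun m => ?_
    rw [integral_map hW'.aemeasurable (by fun_prop)]
    have hpos : (0 : ℝ) < ((m + d).choose d : ℝ) := by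
      exact_mod_cast Nat.choose_pos (Nat.le_add_left d m)
    apply mul_left_cancel₀ hpos.ne'
    rw [hm m, integral_minBeta d (fun w => w ^ m), integral_Icc_eq_integral_Ioc,
      ← intervalIntegral.integral_of_le zero_le_one, ← intervalIntegral.integral_const_mul]
    -- The full beta integral for `m + d` trials equals the tail at `e = 0`, which is `1`; this is
    -- the `m`-th moment of `minBeta d`.
    have := integral_beta_density (Nat.le_add_left d m) 1
    rw [sub_self, binTail_zero hd, Nat.add_sub_cancel] at this
    refine this.symm.trans ?_
    congr 1
    ext w
    push_cast
    ring
  have hmeas : Measurable ((Set.Iic (1 - e)).indicator (fun w : ℝ => w ^ (N - d))) :=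
    Measurable.indicator (by fun_prop) measurableSet_Iic
  have e1 : ∫ ω, (Set.Iic (1 - e)).indicator (fun w => w ^ (N - d)) (W ω) ∂Q =
      ∫ w, (Set.Iic (1 - e)).indicator (fun w => w ^ (N - d)) (w : ℝ) ∂(minBeta d) := by
    rw [← hlaw, integral_map hW'.aemeasurable]
    exact (hmeas.comp measurable_subtype_coe).aestronglyMeasurable
  rw [e1, integral_minBeta]
  have e2 : ∀ w : ℝ, (d : ℝ) * (1 - w) ^ (d - 1) *
      (Set.Iic (1 - e)).indicator (fun w => w ^ (N - d)) w =
      (Set.Iic (1 - e)).indicator (fun w => (d : ℝ) * (1 - w) ^ (d - 1) * w ^ (N - d)) w := by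
    intro w
    by_cases hw : w ∈ Set.Iic (1 - e) <;> simp [hw]
  simp_rw [e2]
  rw [setIntegral_indicator measurableSet_Iic]
  have e3 : Set.Icc (0 : ℝ) 1 ∩ Set.Iic (1 - e) = Set.Icc 0 (1 - e) := by
    ext w
    simp only [Set.mem_inter_iff, Set.mem_Icc, Set.mem_Iic]
    constructor
    · rintro ⟨⟨a, b⟩, c⟩; exact ⟨a, c⟩
    · rintro ⟨a, b⟩; exact ⟨⟨a, by linarith⟩, b⟩
  rw [e3, integral_Icc_eq_integral_Ioc, ← intervalIntegral.integral_of_le (by linarith),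
    ← intervalIntegral.integral_const_mul]
  have := integral_beta_density hN (1 - e)
  rw [sub_sub_cancel] at this
  rw [← this]
  congr 1
  ext w
  push_cast
  ring

/-! ### Samples with a unique supporting subsample -/

section SupportSets

variable {Y : Type*} [MeasurableSpace Y] {d : ℕ}

/-- The restriction of a sample to an index set of cardinality `d`. -/
def subsample {α : Type*} {M : ℕ} (y : Fin M → α) (S : {S : Finset (Fin M) // S.card = d}) :
    Fin d → α :=
  fun i => y (S.1.orderEmbOfFin S.2 i)

/-- No other sample point violates (in the sense of `Vs`) the subsample with indices `S`. -/
def SupportedOn {α : Type*} (Vs : Set ((Fin d → α) × α)) {M : ℕ} (y : Fin M → α)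
    (S : {S : Finset (Fin M) // S.card = d}) : Prop :=
  ∀ j ∉ S.1, (subsample y S, y j) ∉ Vs

theorem measurePreserving_split (Q : Measure Y) [IsProbabilityMeasure Q] {ι κ κ' : Type*}
    [Fintype ι] [Fintype κ] [Fintype κ'] (e : κ ⊕ κ' ≃ ι) :
    MeasurePreserving (fun y : ι → Y => ((fun i => y (e (.inl i))), fun j => y (e (.inr j))))
      (Measure.pi fun _ => Q) ((Measure.pi fun _ => Q).prod (Measure.pi fun _ => Q)) :=
  (measurePreserving_sumPiEquivProdPi fun _ : κ ⊕ κ' => Q).comp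
    (measurePreserving_piCongrLeft (fun _ : ι => Q) e).symm

theorem measurable_subsample {M : ℕ} (S : {S : Finset (Fin M) // S.card = d}) :
    Measurable fun y : Fin M → Y => subsample y S :=
  measurable_pi_lambda _ fun _ => measurable_pi_apply _

theorem measurableSet_supportedOn {Vs : Set ((Fin d → Y) × Y)} (hVs : MeasurableSet Vs) {M : ℕ}
    (S : {S : Finset (Fin M) // S.card = d}) :
    MeasurableSet {y : Fin M → Y | SupportedOn Vs y S} := by
  have : {y : Fin M → Y | SupportedOn Vs y S} =
      ⋂ j, ⋂ (_ : j ∉ S.1), (fun y => (subsample y S, y j)) ⁻¹' Vsᶜ := by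
    ext y
    simp [SupportedOn]
  rw [this]
  refine MeasurableSet.iInter fun j => MeasurableSet.iInter fun _ => ?_
  exact ((measurable_subsample S).prodMk (measurable_pi_apply j)) hVs.compl

/-- Given the subsample `s`, the other `M - d` points are independent and each avoids violation with
the same probability; Fubini turns this into a power. -/
theorem lintegral_supportedOn (Q : Measure Y) [IsProbabilityMeasure Q]
    {Vs : Set ((Fin d → Y) × Y)} (hVs : MeasurableSet Vs) {M : ℕ}
    (S : {S : Finset (Fin M) // S.card = d}) {G : (Fin d → Y) → ℝ≥0∞} (hG : Measurable G) :
    ∫⁻ y, {y | SupportedOn Vs y S}.indicator (fun y => G (subsample y S)) y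
        ∂(Measure.pi fun _ => Q) =
      ∫⁻ s, G s * Q {y' | (s, y') ∉ Vs} ^ (M - d) ∂(Measure.pi fun _ => Q) := by
  classical
  have hc : S.1ᶜ.card = M - d := by rw [Finset.card_compl, S.2, Fintype.card_fin]
  set e := finSumEquivOfFinset S.2 hc
  let T : Set ((Fin d → Y) × (Fin (M - d) → Y)) := {p | ∀ j, (p.1, p.2 j) ∉ Vs}
  have hT : MeasurableSet T := by
    have : T = ⋂ j, (fun p => (p.1, p.2 j)) ⁻¹' Vsᶜ := by
      ext p
      simp [T]
    rw [this]
    refine MeasurableSet.iInter fun j => ?_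
    exact (measurable_fst.prodMk ((measurable_pi_apply j).comp measurable_snd)) hVs.compl
  have hH : Measurable (T.indicator fun p => G p.1) := (hG.comp measurable_fst).indicator hT
  have hΦ := measurePreserving_split Q e
  calc _ = ∫⁻ y, T.indicator (fun p => G p.1)
          ((fun i => y (e (.inl i))), fun j => y (e (.inr j))) ∂(Measure.pi fun _ => Q) := by
        refine lintegral_congr fun y => ?_
        have hiff : SupportedOn Vs y S ↔
            ((fun i => y (e (.inl i))), fun j => y (e (.inr j))) ∈ T := by
          constructor
          · intro h j
            refine h _ ?_
            have : (S.1ᶜ).orderEmbOfFin hc j ∈ S.1ᶜ := Finset.orderEmbOfFin_mem _ hc _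
            exact Finset.mem_compl.1 this
          · intro h j hj
            obtain ⟨i, hi⟩ := e.surjective j
            cases i with
            | inl i =>
              exfalso
              apply hj
              rw [← hi]
              exact Finset.orderEmbOfFin_mem _ S.2 _
            | inr i =>
              rw [← hi]
              exact h i
        by_cases hy : SupportedOn Vs y S
        · rw [Set.indicator_of_mem (by exact hy), Set.indicator_of_mem (hiff.1 hy)]
          rfl
        · rw [Set.indicator_of_notMem (by exact hy),
            Set.indicator_of_notMem (fun h => hy (hiff.2 h))]
    _ = ∫⁻ p, T.indicator (fun p => G p.1) p
          ∂((Measure.pi fun _ => Q).prod (Measure.pi fun _ => Q)) := hΦ.lintegral_comp hH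
    _ = _ := by
        rw [lintegral_prod _ hH.aemeasurable]
        refine lintegral_congr fun s => ?_
        have : ∀ t, T.indicator (fun p => G p.1) (s, t) =
            (Set.univ.pi fun _ => {y' | (s, y') ∉ Vs}).indicator (fun _ => G s) t := by
          intro t
          have hiff : (s, t) ∈ T ↔ t ∈ Set.univ.pi fun _ => {y' | (s, y') ∉ Vs} := by
            simp [T, Set.mem_pi]
          by_cases ht : (s, t) ∈ T
          · rw [Set.indicator_of_mem ht, Set.indicator_of_mem (hiff.1 ht)]
          · rw [Set.indicator_of_notMem ht, Set.indicator_of_notMem (fun h => ht (hiff.2 h))]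
        simp_rw [this]
        have hms : MeasurableSet {y' | (s, y') ∉ Vs} := measurable_prodMk_left hVs.compl
        rw [lintegral_indicator_const (MeasurableSet.univ_pi fun _ => hms), Measure.pi_pi]
        simp

/-- If almost every sample has exactly one supporting subsample of cardinality `d`, the
probability that this subsample is violated with probability at least `e` is a binomial tail. -/
theorem measure_supportedOn_violation_le (Q : Measure Y) [IsProbabilityMeasure Q] (hd : 0 < d)
    {Vs : Set ((Fin d → Y) × Y)} (hVs : MeasurableSet Vs)
    (hex : ∀ M, d ≤ M → ∀ᵐ y ∂(Measure.pi fun _ : Fin M => Q), ∃! S, SupportedOn Vs y S)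
    {N : ℕ} (hN : d ≤ N) {e : ℝ} (he0 : 0 ≤ e) (he1 : e ≤ 1) :
    (Measure.pi fun _ : Fin N => Q) {y | ∃ S, SupportedOn Vs y S ∧
      ENNReal.ofReal e ≤ Q {y' | (subsample y S, y') ∈ Vs}} ≤ ENNReal.ofReal (binTail d N e) := by
  classical
  let R : (Fin d → Y) → ℝ≥0∞ := fun s => Q {y' | (s, y') ∉ Vs}
  let W : (Fin d → Y) → ℝ := fun s => (R s).toReal
  have hR : Measurable R := measurable_measure_prodMk_left hVs.compl
  have hW : Measurable W := hR.ennreal_toReal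
  have hR1 : ∀ s, R s ≤ 1 := fun s => prob_le_one
  have hRW : ∀ s, R s = ENNReal.ofReal (W s) := fun s =>
    (ENNReal.ofReal_toReal ((hR1 s).trans_lt ENNReal.one_lt_top).ne).symm
  have hW0 : ∀ s, 0 ≤ W s := fun s => ENNReal.toReal_nonneg
  have hW1 : ∀ s, W s ≤ 1 := fun s =>
    ENNReal.toReal_le_of_le_ofReal zero_le_one (by simpa using hR1 s)
  have hcard : ∀ M : ℕ, Fintype.card {S : Finset (Fin M) // S.card = d} = M.choose d := by
    intro M
    rw [Fintype.card_finset_len, Fintype.card_fin]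
  -- In a sample of size `m + d` the indicators of the support events sum to `1` almost surely, and
  -- each of the `C(m + d, d)` events has probability `E[W^m]`.
  have hm : ∀ m : ℕ, ((m + d).choose d : ℝ) * ∫ s, W s ^ m ∂(Measure.pi fun _ => Q) = 1 := by
    intro m
    have h1 : ∑ S : {S : Finset (Fin (m + d)) // S.card = d},
        ∫⁻ y, {y | SupportedOn Vs y S}.indicator (fun y => (fun _ => 1) (subsample y S)) y
          ∂(Measure.pi fun _ => Q) = 1 := by
      rw [← lintegral_finsetSum]
      · have : ∀ᵐ y ∂(Measure.pi fun _ : Fin (m + d) => Q),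
            ∑ S : {S : Finset (Fin (m + d)) // S.card = d},
              {y | SupportedOn Vs y S}.indicator (fun _ => (1 : ℝ≥0∞)) y = 1 := by
          filter_upwards [hex (m + d) (Nat.le_add_left d m)] with y hy
          obtain ⟨S, hS, hu⟩ := hy
          rw [Finset.sum_eq_single_of_mem S (Finset.mem_univ S)]
          · exact Set.indicator_of_mem hS _
          · intro S' _ hne
            exact Set.indicator_of_notMem (fun h => hne (hu S' h)) _
        rw [lintegral_congr_ae this]
        simp
      · intro S _
        exact measurable_const.indicator (measurableSet_supportedOn hVs S)
    simp_rw [lintegral_supportedOn Q hVs _ measurable_const, one_mul, Nat.add_sub_cancel] at h1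
    rw [Finset.sum_const, Finset.card_univ, hcard, nsmul_eq_mul] at h1
    rw [integral_eq_lintegral_of_nonneg_ae (.of_forall fun s => pow_nonneg (hW0 s) m)
      (hW.pow_const m).aestronglyMeasurable]
    have h2 : ∀ s, ENNReal.ofReal (W s ^ m) = R s ^ m := by
      intro s
      rw [ENNReal.ofReal_pow (hW0 s), ← hRW]
    simp_rw [h2]
    have := congrArg ENNReal.toReal h1
    rw [ENNReal.toReal_mul] at this
    simpa using this
  have key := truncated_moment_of_moments (Measure.pi fun _ : Fin d => Q) hd W hW hW0 hW1 hm hN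
    he0 he1
  let A : Set (Fin d → Y) := {s | W s ≤ 1 - e}
  have hA : MeasurableSet A := measurableSet_le hW measurable_const
  -- A violation probability of at least `e` means `W ≤ 1 - e`, so each index set contributes a
  -- truncated moment of `W`.
  have hbound : ∀ S : {S : Finset (Fin N) // S.card = d},
      (Measure.pi fun _ : Fin N => Q) {y | SupportedOn Vs y S ∧
        ENNReal.ofReal e ≤ Q {y' | (subsample y S, y') ∈ Vs}} ≤
      ENNReal.ofReal (∫ s, (Set.Iic (1 - e)).indicator (fun w => w ^ (N - d)) (W s)
        ∂(Measure.pi fun _ : Fin d => Q)) := by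
    intro S
    have hsub : {y | SupportedOn Vs y S ∧
        ENNReal.ofReal e ≤ Q {y' | (subsample y S, y') ∈ Vs}} ⊆
        {y | SupportedOn Vs y S} ∩ (fun y => subsample y S) ⁻¹' A := by
      rintro y ⟨h1, h2⟩
      refine ⟨h1, ?_⟩
      have hms : MeasurableSet {y' | (subsample y S, y') ∈ Vs} := measurable_prodMk_left hVs
      have h3 : R (subsample y S) = 1 - Q {y' | (subsample y S, y') ∈ Vs} :=
        prob_compl_eq_one_sub hms
      have h4 : R (subsample y S) ≤ ENNReal.ofReal (1 - e) := by
        rw [h3, ENNReal.ofReal_sub _ he0, ENNReal.ofReal_one]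
        exact tsub_le_tsub_left h2 _
      exact ENNReal.toReal_le_of_le_ofReal (by linarith) h4
    refine (measure_mono hsub).trans (le_of_eq ?_)
    have hms := (measurableSet_supportedOn hVs S).inter (measurable_subsample S hA)
    have := lintegral_supportedOn Q hVs S (measurable_one.indicator hA : Measurable (A.indicator 1))
    have h5 : ∀ y, {y | SupportedOn Vs y S}.indicator
        (fun y => A.indicator (1 : (Fin d → Y) → ℝ≥0∞) (subsample y S)) y =
        ({y | SupportedOn Vs y S} ∩ (fun y => subsample y S) ⁻¹' A).indicator 1 y := by
      intro y
      rw [Set.inter_indicator_one]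
      by_cases h1 : SupportedOn Vs y S <;> by_cases h2 : subsample y S ∈ A <;>
        simp [Set.indicator, h1, h2]
    simp_rw [h5] at this
    rw [lintegral_indicator_one hms] at this
    have hind : ∀ s, (Set.Iic (1 - e)).indicator (fun w : ℝ => w ^ (N - d)) (W s) =
        A.indicator (fun s => W s ^ (N - d)) s := fun s => rfl
    simp_rw [hind]
    have hmA : Measurable (A.indicator fun s => W s ^ (N - d)) := (hW.pow_const _).indicator hA
    have hb : ∀ s, 0 ≤ A.indicator (fun s => W s ^ (N - d)) s :=
      fun s => Set.indicator_nonneg (fun s _ => pow_nonneg (hW0 s) _) s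
    rw [this, ofReal_integral_eq_lintegral_ofReal _ (.of_forall hb)]
    · refine lintegral_congr fun s => ?_
      by_cases hs : s ∈ A
      · rw [Set.indicator_of_mem hs, Set.indicator_of_mem hs, ENNReal.ofReal_pow (hW0 s), ← hRW]
        simp [R]
      · simp [Set.indicator_of_notMem hs]
    · refine Integrable.of_bound hmA.aestronglyMeasurable 1 (.of_forall fun s => ?_)
      rw [Real.norm_of_nonneg (hb s)]
      exact Set.indicator_le' (fun s _ => pow_le_one₀ (hW0 s) (hW1 s)) (fun _ _ => zero_le_one) s
  have hunion : {y | ∃ S, SupportedOn Vs y S ∧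
      ENNReal.ofReal e ≤ Q {y' | (subsample y S, y') ∈ Vs}} =
      ⋃ S, {y : Fin N → Y | SupportedOn Vs y S ∧
        ENNReal.ofReal e ≤ Q {y' | (subsample y S, y') ∈ Vs}} := by
    ext y
    simp
  rw [hunion, ← key]
  refine (measure_iUnion_le _).trans ?_
  rw [tsum_fintype]
  refine (Finset.sum_le_sum fun S _ => hbound S).trans ?_
  rw [Finset.sum_const, Finset.card_univ, hcard, nsmul_eq_mul,
    ENNReal.ofReal_mul (by positivity), ENNReal.ofReal_natCast]

end SupportSets

/-! ### Uniqueness of the padded basis -/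

theorem exists_top_subset {ι β : Type*} [DecidableEq ι] [LinearOrder β] {u : ι → β}
    (hu : Function.Injective u) (C : Finset ι) : ∀ k ≤ C.card, ∃ P ⊆ C, P.card = k ∧
      ∀ i ∈ P, ∀ j ∈ C, j ∉ P → u j < u i := by
  intro k
  induction k with
  | zero => exact fun _ => ⟨∅, by simp⟩
  | succ k ih =>
    intro hk
    obtain ⟨P, hPC, hPk, hP⟩ := ih (by omega)
    have hne : (C \ P).Nonempty := by
      rw [← Finset.card_pos, Finset.card_sdiff_of_subset hPC]
      omega
    obtain ⟨m, hm, hmax⟩ := Finset.exists_max_image (C \ P) u hne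
    rw [Finset.mem_sdiff] at hm
    refine ⟨insert m P, Finset.insert_subset hm.1 hPC,
      by rw [Finset.card_insert_of_notMem hm.2, hPk], ?_⟩
    intro i hi j hj hjP
    rw [Finset.mem_insert, not_or] at hjP
    rcases Finset.mem_insert.1 hi with rfl | hi
    · exact lt_of_le_of_ne (hmax j (Finset.mem_sdiff.2 ⟨hj, hjP.2⟩)) fun h => hjP.1 (hu h)
    · exact hP i hi j hj hjP.2

/-- A nondegenerate problem of combinatorial dimension at most `d`, regularized by padding its
basis with the remaining elements of largest mark `u`, has a unique support set of size `d`. -/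
theorem existsUnique_support {ι α β : Type*} [Fintype ι] [DecidableEq ι] [LinearOrder α]
    [LinearOrder β] {d : ℕ} (w : Finset ι → α) (hmono : Monotone w)
    (hloc : ∀ S, (∀ j, w (insert j S) = w S) → w S = w Finset.univ)
    (hdim : ∃ B : Finset ι, B.card ≤ d ∧ w B = w Finset.univ)
    (hnd : ∀ (A A' : Finset ι) (i : ι), i ∈ A' → i ∉ A → w (A'.erase i) < w A' → w A ≠ w A')
    {u : ι → β} (hu : Function.Injective u) (hd : d ≤ Fintype.card ι) :
    ∃! S : {S : Finset ι // S.card = d}, ∀ j ∉ S.1,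
      ¬ (w S.1 < w (insert j S.1) ∨ ∃ i ∈ S.1, w (S.1.erase i) = w S.1 ∧ u i < u j) := by
  classical
  -- A basis of least cardinality: removing any element strictly lowers the value.
  obtain ⟨B, hBw, hBcard, hBmin⟩ : ∃ B : Finset ι, w B = w Finset.univ ∧ B.card ≤ d ∧
      ∀ i ∈ B, w (B.erase i) < w B := by
    obtain ⟨B₀, h₀, h₀'⟩ := hdim
    obtain ⟨B, hB, hmin⟩ := Finset.exists_min_image
      (Finset.univ.filter fun B : Finset ι => w B = w Finset.univ) Finset.card
      ⟨B₀, by simpa using h₀'⟩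
    simp only [Finset.mem_filter, Finset.mem_univ, true_and] at hB hmin
    refine ⟨B, hB, (hmin B₀ h₀').trans h₀, fun i hi => ?_⟩
    refine lt_of_le_of_ne (hmono (Finset.erase_subset i B)) fun h => ?_
    have := hmin _ (h.trans hB)
    have := Finset.card_erase_lt_of_mem hi
    omega
  -- Nondegeneracy: a set missing an essential element of `B` cannot attain the same value, so `B`
  -- lies in every set of full value.
  have hsub : ∀ S, w S = w Finset.univ → B ⊆ S := by
    intro S hS i hi
    by_contra hiS
    exact hnd S B i hi hiS (hBmin i hi) (hS.trans hBw.symm)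
  have hsup : ∀ S, B ⊆ S → w S = w Finset.univ := fun S hS =>
    le_antisymm (hmono (Finset.subset_univ S)) (hBw ▸ hmono hS)
  obtain ⟨P, hPB, hPcard, hP⟩ := exists_top_subset hu Bᶜ (d - B.card)
    (by rw [Finset.card_compl]; omega)
  have hdisj : Disjoint B P := Finset.disjoint_of_subset_right hPB disjoint_compl_right
  refine ⟨⟨B ∪ P, ?_⟩, ?_, ?_⟩
  · rw [Finset.card_union_of_disjoint hdisj, hPcard]
    omega
  · intro j hj
    have hjB : j ∉ B := fun h => hj (Finset.mem_union_left _ h)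
    have hjP : j ∉ P := fun h => hj (Finset.mem_union_right _ h)
    have hw := hsup (B ∪ P) Finset.subset_union_left
    rintro (h | ⟨i, hi, hi', hij⟩)
    · refine absurd h (not_lt.2 ?_)
      rw [hw]
      exact hmono (Finset.subset_univ _)
    · rcases Finset.mem_union.1 hi with hiB | hiP
      · exact Finset.notMem_erase i _ (hsub _ (hi'.trans hw) hiB)
      · exact lt_asymm hij (hP i hiP j (Finset.mem_compl.2 hjB) hjP)
  · have hS : ∀ S : Finset ι, (∀ j ∉ S, ¬ (w S < w (insert j S) ∨
        ∃ i ∈ S, w (S.erase i) = w S ∧ u i < u j)) →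
        B ⊆ S ∧ ∀ i ∈ S, i ∉ B → ∀ j ∉ S, ¬ u i < u j := by
      intro S h
      have hw : w S = w Finset.univ := by
        refine hloc S fun j => ?_
        by_cases hj : j ∈ S
        · rw [Finset.insert_eq_of_mem hj]
        · have := h j hj
          rw [not_or, not_lt] at this
          exact le_antisymm this.1 (hmono (Finset.subset_insert j S))
      refine ⟨hsub S hw, fun i hi hiB j hj hij => h j hj (.inr ⟨i, hi, ?_, hij⟩)⟩
      rw [hw]
      exact hsup _ (Finset.subset_erase.2 ⟨hsub S hw, hiB⟩)
    -- Exchange argument: for `i ∈ S \ S'` and `j ∈ S' \ S`, both outside `B`, neither mark is below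
    -- the other, contradicting injectivity of `u`.
    have huniq : ∀ S S' : {S : Finset ι // S.card = d}, (∀ j ∉ S.1, ¬ (w S.1 < w (insert j S.1) ∨
        ∃ i ∈ S.1, w (S.1.erase i) = w S.1 ∧ u i < u j)) →
        (B ⊆ S'.1 ∧ ∀ i ∈ S'.1, i ∉ B → ∀ j ∉ S'.1, ¬ u i < u j) → S = S' := by
      intro S S' h h'
      obtain ⟨hB, hSu⟩ := hS S.1 h
      obtain ⟨hB', hSu'⟩ := h'
      apply Subtype.ext
      refine Finset.eq_of_subset_of_card_le (fun i hi => ?_) (by rw [S.2, S'.2])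
      by_contra hi'
      have : ∃ j ∈ S'.1, j ∉ S.1 := by
        by_contra hcon
        push Not at hcon
        have := Finset.eq_of_subset_of_card_le hcon (by rw [S.2, S'.2])
        exact hi' (this ▸ hi)
      obtain ⟨j, hj', hj⟩ := this
      have h1 := hSu i hi (fun h => hi' (hB' h)) j hj
      have h2 := hSu' j hj' (fun h => hj (hB h)) i hi'
      have := hu (le_antisymm (not_lt.1 h2) (not_lt.1 h1))
      exact hj (this ▸ hi)
    intro S h
    refine huniq S _ h ⟨Finset.subset_union_left, fun i hi hiB j hj => ?_⟩
    rw [Finset.mem_union, not_or] at hj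
    have hiP : i ∈ P := (Finset.mem_union.1 hi).resolve_left hiB
    exact not_lt.2 (hP i hiP j (Finset.mem_compl.2 hj.1) hj.2).le

/-! ### Strictly convex min-max programs -/

section MinMax

variable {E Y : Type*}

/-- The optimal value of the min-max problem over `K` with the constraints `Z`. -/
noncomputable def mmVal (K : Set E) (F : E → Y → ℝ) (Z : Set Y) : EReal :=
  ⨅ Ψ ∈ K, ⨆ y ∈ Z, (F Ψ y : EReal)

variable {K : Set E} {F : E → Y → ℝ}

theorem mmVal_mono {Z Z' : Set Y} (h : Z ⊆ Z') : mmVal K F Z ≤ mmVal K F Z' :=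
  iInf₂_mono fun _ _ => biSup_mono h

theorem mmVal_le {Z : Set Y} {c : EReal} {Ψ : E} (hΨ : Ψ ∈ K) (h : ∀ y ∈ Z, (F Ψ y : EReal) ≤ c) :
    mmVal K F Z ≤ c :=
  (iInf₂_le Ψ hΨ).trans (iSup₂_le h)

/-- A supremum of continuous functions is lower semicontinuous and attains its minimum on a compact
set, even for infinite `Z`. -/
theorem exists_argmin [TopologicalSpace E] (hK : IsCompact K) (hne : K.Nonempty)
    (hF : ∀ y, ContinuousOn (fun Ψ => F Ψ y) K) (Z : Set Y) :
    ∃ Ψ ∈ K, ∀ y ∈ Z, (F Ψ y : EReal) ≤ mmVal K F Z := by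
  have hlsc : LowerSemicontinuousOn (fun Ψ => ⨆ y ∈ Z, (F Ψ y : EReal)) K :=
    lowerSemicontinuousOn_biSup fun y _ =>
      (continuous_coe_real_ereal.comp_continuousOn (hF y)).lowerSemicontinuousOn
  obtain ⟨Ψ, hΨ, hmin⟩ := hlsc.exists_isMinOn hne hK
  refine ⟨Ψ, hΨ, fun y hy => ?_⟩
  refine le_trans ?_ (le_iInf₂ fun Ψ' hΨ' => hmin hΨ')
  exact le_iSup₂ (f := fun y _ => (F Ψ y : EReal)) y hy

theorem mmVal_lt {Z : Set Y} (hZ : Z.Finite) {c : EReal} (hc : ⊥ < c) {Ψ : E} (hΨ : Ψ ∈ K)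
    (h : ∀ y ∈ Z, (F Ψ y : EReal) < c) : mmVal K F Z < c := by
  rcases Z.eq_empty_or_nonempty with rfl | hne
  · exact lt_of_le_of_lt (mmVal_le hΨ (c := ⊥) (by simp)) hc
  · obtain ⟨y, hy, hmax⟩ := Set.exists_max_image Z (F Ψ) hZ hne
    exact lt_of_le_of_lt (mmVal_le hΨ fun y' hy' => EReal.coe_le_coe_iff.2 (hmax y' hy')) (h y hy)

/-- Since minimizers exist, a strict sublevel set is a union over `Ψ` of finite intersections of
open sets; openness makes the uncountable union harmless. -/
theorem measurable_mmVal [TopologicalSpace E] (hK : IsCompact K) (hne : K.Nonempty)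
    (hF : ∀ y, ContinuousOn (fun Ψ => F Ψ y) K) [TopologicalSpace Y] [SecondCountableTopology Y]
    [MeasurableSpace Y] [BorelSpace Y] (hF' : ∀ Ψ ∈ K, Continuous (F Ψ)) (κ : Type*) [Finite κ] :
    Measurable fun y : κ → Y => mmVal K F (Set.range y) := by
  refine measurable_of_Iio fun c => ?_
  rcases eq_bot_or_bot_lt c with rfl | hc
  · simp
  · have : (fun y : κ → Y => mmVal K F (Set.range y)) ⁻¹' Set.Iio c =
        ⋃ Ψ ∈ K, ⋂ i, {y : κ → Y | (F Ψ (y i) : EReal) < c} := by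
      ext y
      simp only [Set.mem_preimage, Set.mem_Iio, Set.mem_iUnion, Set.mem_iInter, exists_prop]
      constructor
      · intro h
        obtain ⟨Ψ, hΨ, h'⟩ := exists_argmin hK hne hF (Set.range y)
        exact ⟨Ψ, hΨ, fun i => (h' _ ⟨i, rfl⟩).trans_lt h⟩
      · rintro ⟨Ψ, hΨ, h⟩
        refine mmVal_lt (Set.finite_range y) hc hΨ ?_
        rintro _ ⟨i, rfl⟩
        exact h i
    rw [this]
    refine IsOpen.measurableSet (isOpen_biUnion fun Ψ hΨ => isOpen_iInter_of_finite fun i => ?_)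
    exact isOpen_lt (continuous_coe_real_ereal.comp ((hF' Ψ hΨ).comp (continuous_apply i)))
      continuous_const

theorem bot_lt_mmVal [TopologicalSpace E] (hK : IsCompact K) (hne : K.Nonempty)
    (hF : ∀ y, ContinuousOn (fun Ψ => F Ψ y) K) {Z : Set Y} (hZ : Z.Nonempty) :
    ⊥ < mmVal K F Z := by
  obtain ⟨Ψ, _, h⟩ := exists_argmin hK hne hF Z
  obtain ⟨y, hy⟩ := hZ
  exact (EReal.bot_lt_coe _).trans_le (h y hy)

theorem exists_coe_eq_mmVal [TopologicalSpace E] (hK : IsCompact K) (hne : K.Nonempty)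
    (hF : ∀ y, ContinuousOn (fun Ψ => F Ψ y) K) {Z : Set Y} (hfin : Z.Finite) (hZ : Z.Nonempty) :
    ∃ c : ℝ, mmVal K F Z = c := by
  have h1 := bot_lt_mmVal hK hne hF hZ
  have h2 : mmVal K F Z < ⊤ := by
    obtain ⟨Ψ, hΨ⟩ := hne
    exact mmVal_lt hfin bot_lt_top hΨ fun y _ => EReal.coe_lt_top _
  exact ⟨(mmVal K F Z).toReal, (EReal.coe_toReal h2.ne h1.ne').symm⟩

variable [NormedAddCommGroup E] [NormedSpace ℝ E]

/-- A compact convex program whose constraint functions are strictly convex in the decision. -/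
structure IsMinMaxProgram (K : Set E) (F : E → Y → ℝ) : Prop where
  isCompact : IsCompact K
  nonempty : K.Nonempty
  continuousOn : ∀ y, ContinuousOn (fun Ψ => F Ψ y) K
  strictConvexOn : ∀ y, StrictConvexOn ℝ K fun Ψ => F Ψ y
  convex : Convex ℝ K

namespace IsMinMaxProgram

/-- The midpoint of two distinct minimizers would be strictly better in each of the finitely many
constraints. -/
theorem argmin_unique (h : IsMinMaxProgram K F)
    {Z : Set Y} (hfin : Z.Finite) (hZ : Z.Nonempty) {Ψ Ψ' : E} (hΨ : Ψ ∈ K)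
    (hΨ' : Ψ' ∈ K) (h₁ : ∀ y ∈ Z, (F Ψ y : EReal) ≤ mmVal K F Z)
    (h₂ : ∀ y ∈ Z, (F Ψ' y : EReal) ≤ mmVal K F Z) : Ψ = Ψ' := by
  by_contra hne
  obtain ⟨c, hc⟩ := exists_coe_eq_mmVal h.isCompact h.nonempty h.continuousOn hfin hZ
  rw [hc] at h₁ h₂
  have hlt : mmVal K F Z < c := by
    refine mmVal_lt hfin (EReal.bot_lt_coe c)
      (h.convex hΨ hΨ' (a := 1 / 2) (b := 1 / 2) (by norm_num) (by norm_num) (by norm_num))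
      fun y hy => EReal.coe_lt_coe_iff.2 ?_
    have h3 := (h.strictConvexOn y).2 hΨ hΨ' hne (by norm_num : (0 : ℝ) < 1 / 2)
      (by norm_num : (0 : ℝ) < 1 / 2) (by norm_num)
    have h4 := EReal.coe_le_coe_iff.1 (h₁ y hy)
    have h5 := EReal.coe_le_coe_iff.1 (h₂ y hy)
    simp only [smul_eq_mul] at h3
    linarith
  exact hlt.ne hc

/-- Locality: a minimizer for the enlarged constraint set also minimizes over `Z`, so by uniqueness
it is `Ψ`. -/
theorem le_of_mmVal_insert_le (h : IsMinMaxProgram K F)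
    {Z : Set Y} (hfin : Z.Finite) (hZ : Z.Nonempty) {y : Y}
    (hy : mmVal K F (insert y Z) ≤ mmVal K F Z) {Ψ : E} (hΨ : Ψ ∈ K)
    (h₁ : ∀ y ∈ Z, (F Ψ y : EReal) ≤ mmVal K F Z) : (F Ψ y : EReal) ≤ mmVal K F Z := by
  obtain ⟨Ψ', hΨ', h'⟩ := exists_argmin h.isCompact h.nonempty h.continuousOn (insert y Z)
  have := h.argmin_unique hfin hZ hΨ hΨ' h₁
    fun y' hy' => (h' y' (Set.mem_insert_of_mem _ hy')).trans hy
  rw [this]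
  exact (h' y (Set.mem_insert _ _)).trans hy

theorem mmVal_eq_of_forall_insert (h : IsMinMaxProgram K F)
    {Z T : Set Y} (hfin : Z.Finite) (hZ : Z.Nonempty) (hZT : Z ⊆ T)
    (hT : ∀ y ∈ T, mmVal K F (insert y Z) ≤ mmVal K F Z) : mmVal K F Z = mmVal K F T := by
  refine le_antisymm (mmVal_mono hZT) ?_
  obtain ⟨Ψ, hΨ, h'⟩ := exists_argmin h.isCompact h.nonempty h.continuousOn Z
  exact mmVal_le hΨ fun y hy => h.le_of_mmVal_insert_le hfin hZ (hT y hy) hΨ h'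

/-- If every subfamily of at most `dim + 1` constraints had value below the optimum `c`, the convex
sets `{F < c}` would have a common point by Helly, forcing the optimum below `c`. -/
theorem exists_small_basis [FiniteDimensional ℝ E] (h : IsMinMaxProgram K F)
    {ι : Type*} (A : Finset ι) (y : ι → Y) :
    ∃ B : Finset ι, B ⊆ A ∧ B.card ≤ Module.finrank ℝ E + 1 ∧
      mmVal K F (y '' B) = mmVal K F (y '' A) := by
  classical
  rcases A.eq_empty_or_nonempty with rfl | hA
  · exact ⟨∅, by simp⟩
  by_contra hcon
  push Not at hcon
  have hlt : ∀ B ⊆ A, B.card ≤ Module.finrank ℝ E + 1 →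
      mmVal K F (y '' B) < mmVal K F (y '' A) := fun B hB hc =>
    lt_of_le_of_ne (mmVal_mono (Set.image_mono (by exact_mod_cast hB))) (hcon B hB hc)
  obtain ⟨c, hc⟩ := exists_coe_eq_mmVal h.isCompact h.nonempty h.continuousOn
    (A.finite_toSet.image y) ((Finset.coe_nonempty.2 hA).image y)
  rw [hc] at hlt
  obtain ⟨Ψ, hΨ⟩ := Convex.helly_theorem' (𝕜 := ℝ) (s := A) (F := fun i => {Ψ ∈ K | F Ψ (y i) < c})
    (fun i _ => (h.strictConvexOn (y i)).convexOn.convex_lt c) (fun B hB hBc => by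
      obtain ⟨Ψ, hΨ, h'⟩ := exists_argmin h.isCompact h.nonempty h.continuousOn (y '' B)
      refine ⟨Ψ, Set.mem_iInter₂.2 fun i hi => ⟨hΨ, ?_⟩⟩
      exact EReal.coe_lt_coe_iff.1
        ((h' (y i) (Set.mem_image_of_mem y hi)).trans_lt (hlt B hB hBc)))
  rw [Set.mem_iInter₂] at hΨ
  obtain ⟨i, hi⟩ := hA
  have : mmVal K F (y '' A) < c := by
    refine mmVal_lt (A.finite_toSet.image y) (EReal.bot_lt_coe c) (hΨ i hi).1 ?_
    rintro _ ⟨j, hj, rfl⟩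
    exact EReal.coe_lt_coe_iff.2 (hΨ j hj).2
  exact this.ne hc

/-- A constraint that raises the optimal value cannot be relaxed without lowering it. -/
theorem mmVal_insert_lt (h : IsMinMaxProgram K F)
    {Z : Set Y} (hfin : Z.Finite) {y₁ y₂ : Y}
    (hlt : ∀ Ψ ∈ K, F Ψ y₁ < F Ψ y₂) (hess : mmVal K F Z < mmVal K F (insert y₂ Z)) :
    mmVal K F (insert y₁ Z) < mmVal K F (insert y₂ Z) := by
  obtain ⟨r, hr⟩ := exists_coe_eq_mmVal h.isCompact h.nonempty h.continuousOn (hfin.insert y₂)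
    (Set.insert_nonempty _ _)
  obtain ⟨Ψ, hΨ, h₁⟩ := exists_argmin h.isCompact h.nonempty h.continuousOn (insert y₂ Z)
  obtain ⟨Ψ', hΨ', h₂⟩ := exists_argmin h.isCompact h.nonempty h.continuousOn Z
  rw [hr] at h₁ hess ⊢
  have ha : F Ψ y₁ < r :=
    (hlt Ψ hΨ).trans_le (EReal.coe_le_coe_iff.1 (h₁ y₂ (Set.mem_insert _ _)))
  -- Move from `Ψ` towards `Ψ'`: every constraint of `Z` becomes strict for `t > 0`, and `t` is
  -- chosen to use at most half of the slack of `y₁` when `Ψ'` violates it.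
  obtain ⟨t, ht0, ht1, ht⟩ : ∃ t : ℝ, 0 < t ∧ t ≤ 1 ∧ (1 - t) * F Ψ y₁ + t * F Ψ' y₁ < r := by
    by_cases hb : F Ψ' y₁ < r
    · exact ⟨1, by norm_num, le_rfl, by simpa using hb⟩
    · have hpos : 0 < F Ψ' y₁ - F Ψ y₁ := by linarith
      refine ⟨(r - F Ψ y₁) / (2 * (F Ψ' y₁ - F Ψ y₁)), by
        apply div_pos <;> linarith, by rw [div_le_one (by linarith)]; linarith, ?_⟩
      have : (r - F Ψ y₁) / (2 * (F Ψ' y₁ - F Ψ y₁)) * (F Ψ' y₁ - F Ψ y₁) = (r - F Ψ y₁) / 2 := by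
        field_simp
      linarith
  have ht' : 0 ≤ 1 - t := by linarith
  refine mmVal_lt (hfin.insert y₁) (EReal.bot_lt_coe r)
    (h.convex hΨ hΨ' ht' ht0.le (by ring)) fun y hy => EReal.coe_lt_coe_iff.2 ?_
  have hconv := (h.strictConvexOn y).convexOn.2 hΨ hΨ' ht' ht0.le (by ring)
  simp only [smul_eq_mul] at hconv
  rcases Set.mem_insert_iff.1 hy with rfl | hy
  · exact hconv.trans_lt ht
  · have h3 := EReal.coe_le_coe_iff.1 (h₁ y (Set.mem_insert_of_mem _ hy))
    have h4 := EReal.coe_lt_coe_iff.1 ((h₂ y hy).trans_lt hess)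
    refine hconv.trans_lt ?_
    nlinarith

end IsMinMaxProgram

end MinMax

/-! ### Independent uniform marks -/

section Marks

open unitInterval

variable {X : Type*} [MeasurableSpace X]

/-- A property of samples with continuously distributed marks holds almost surely if, for a fixed
index `i`, its failure determines the mark with index `i`. -/
theorem ae_of_mark_unique (P : Measure X) [IsProbabilityMeasure P] {M : ℕ} (i : Fin M)
    {s : Set (Fin M → X × I)} (hs : MeasurableSet s)
    (huniq : ∀ (y : Fin M → X × I) (x : X) (u₁ u₂ : I), u₁ < u₂ →
      Function.update y i (x, u₁) ∈ s → Function.update y i (x, u₂) ∉ s) :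
    (Measure.pi fun _ : Fin M => P.prod (volume : Measure I)) s = 0 := by
  have h1 : ∫⁻ y, s.indicator 1 y ∂(Measure.pi fun _ : Fin M => P.prod (volume : Measure I)) =
      ∫⁻ _, 0 ∂(Measure.pi fun _ : Fin M => P.prod (volume : Measure I)) := by
    -- Integrate out coordinate `i` first: for a fixed state the section in the mark has at most one
    -- point, and Lebesgue measure has no atoms.
    refine lintegral_eq_of_lmarginal_eq {i} (measurable_one.indicator hs) measurable_const ?_
    rw [lmarginal_singleton, lmarginal_singleton]
    ext y
    have hm : Measurable fun p : X × I => Function.update y i p := measurable_update y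
    have : ∀ p, s.indicator (1 : (Fin M → X × I) → ℝ≥0∞) (Function.update y i p) =
        ((fun p => Function.update y i p) ⁻¹' s).indicator 1 p := fun p => rfl
    simp_rw [this]
    rw [lintegral_indicator_one (hm hs), lintegral_zero, Measure.measure_prod_null (hm hs)]
    refine .of_forall fun x => ?_
    refine Set.Subsingleton.measure_zero ?_ _
    intro u₁ h₁ u₂ h₂
    by_contra hne
    rcases lt_or_gt_of_ne hne with hlt | hlt
    · exact huniq y x u₁ u₂ hlt h₁ h₂
    · exact huniq y x u₂ u₁ hlt h₂ h₁
  rw [lintegral_indicator_one hs] at h1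
  simpa using h1

theorem ae_injective_marks (P : Measure X) [IsProbabilityMeasure P] (M : ℕ) :
    ∀ᵐ y ∂(Measure.pi fun _ : Fin M => P.prod (volume : Measure I)),
      Function.Injective fun i => (y i).2 := by
  have : ∀ᵐ y ∂(Measure.pi fun _ : Fin M => P.prod (volume : Measure I)),
      ∀ i j : Fin M, i ≠ j → (y i).2 ≠ (y j).2 := by
    rw [ae_all_iff]; intro i
    rw [ae_all_iff]; intro j
    by_cases hij : i = j
    · simp [hij]
    have := ae_of_mark_unique P i (s := {y : Fin M → X × I | (y i).2 = (y j).2})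
      (measurableSet_eq_fun (measurable_snd.comp (measurable_pi_apply i))
        (measurable_snd.comp (measurable_pi_apply j))) (by
        intro y x u₁ u₂ hlt h₁ h₂
        simp only [Set.mem_ofPred_eq, Function.update_self, Function.update_of_ne (Ne.symm hij)]
          at h₁ h₂
        exact hlt.ne (h₁.trans h₂.symm))
    rw [ae_iff]
    simpa [hij] using this
  filter_upwards [this] with y hy i j h
  by_contra hne
  exact hy i j hne h

end Marks

/-! ### The violation bound for marked programs -/

section MarkedProgram

open unitInterval

variable {X E : Type*} {K : Set E} {F : E → X × I → ℝ}

/-- The samples that violate the padded min-max program: they raise its optimal value, or their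
mark exceeds the mark of an inessential constraint. -/
def paddedViolation (K : Set E) (F : E → X × I → ℝ) (d : ℕ) :
    Set ((Fin d → X × I) × (X × I)) :=
  {p | mmVal K F (Set.range p.1) < mmVal K F (insert p.2 (Set.range p.1)) ∨
    ∃ i, mmVal K F (p.1 '' {i}ᶜ) = mmVal K F (Set.range p.1) ∧ (p.1 i).2 < p.2.2}

theorem image_subsample {α : Type*} {d M : ℕ} (y : Fin M → α)
    (S : {S : Finset (Fin M) // S.card = d}) : Set.range (subsample y S) = y '' S.1 := by
  have : subsample y S = y ∘ S.1.orderEmbOfFin S.2 := rfl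
  rw [this, Set.range_comp, Finset.range_orderEmbOfFin]

theorem subsample_image_compl {α : Type*} {d M : ℕ} (y : Fin M → α)
    (S : {S : Finset (Fin M) // S.card = d}) (i : Fin d) :
    subsample y S '' {i}ᶜ = y '' (S.1.erase (S.1.orderEmbOfFin S.2 i)) := by
  have : subsample y S = y ∘ S.1.orderEmbOfFin S.2 := rfl
  rw [this, Set.image_comp, Set.compl_eq_univ_sdiff,
    Set.image_sdiff (S.1.orderEmbOfFin S.2).injective,
    Set.image_univ, Finset.range_orderEmbOfFin, Set.image_singleton, Finset.coe_erase]

theorem supportedOn_paddedViolation_iff {d M : ℕ} (y : Fin M → X × I)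
    (S : {S : Finset (Fin M) // S.card = d}) :
    SupportedOn (paddedViolation K F d) y S ↔ ∀ j ∉ S.1,
      ¬ (mmVal K F (y '' S.1) < mmVal K F (y '' (insert j S.1 : Finset (Fin M))) ∨
        ∃ i ∈ S.1, mmVal K F (y '' (S.1.erase i)) = mmVal K F (y '' S.1) ∧ (y i).2 < (y j).2) := by
  refine forall₂_congr fun j _ => not_congr (or_congr ?_ ?_)
  · simp only [image_subsample, Finset.coe_insert, Set.image_insert_eq]
  · simp only [image_subsample, subsample_image_compl]
    constructor
    · rintro ⟨i, hi⟩
      exact ⟨_, Finset.orderEmbOfFin_mem _ S.2 i, hi⟩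
    · rintro ⟨i, hi, hi'⟩
      have : i ∈ Set.range (S.1.orderEmbOfFin S.2) := by
        rw [Finset.range_orderEmbOfFin]
        exact hi
      obtain ⟨i, rfl⟩ := this
      exact ⟨i, hi'⟩

variable [MeasurableSpace X] [NormedAddCommGroup E] [NormedSpace ℝ E] [TopologicalSpace X]
  [SecondCountableTopology X] [BorelSpace X]

theorem measurable_mmVal_image (h : IsMinMaxProgram K F) (hF : ∀ Ψ ∈ K, Continuous (F Ψ))
    {κ : Type*} (A : Set κ) [Finite A] : Measurable fun y : κ → X × I => mmVal K F (y '' A) := by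
  have := (measurable_mmVal h.isCompact h.nonempty h.continuousOn hF A).comp
    (measurable_pi_lambda (fun (y : κ → X × I) (i : A) => y i) fun i => measurable_pi_apply _)
  simpa only [Function.comp_def, ← Set.image_eq_range] using this

theorem measurableSet_paddedViolation (h : IsMinMaxProgram K F) (hF : ∀ Ψ ∈ K, Continuous (F Ψ))
    (d : ℕ) : MeasurableSet (paddedViolation K F d) := by
  have m0 : ∀ κ : Type, [Finite κ] → Measurable fun y : κ → X × I => mmVal K F (Set.range y) :=
    fun κ _ => measurable_mmVal h.isCompact h.nonempty h.continuousOn hF κ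
  have m1 : Measurable fun p : (Fin d → X × I) × (X × I) => mmVal K F (Set.range p.1) :=
    (m0 (Fin d)).comp measurable_fst
  have m2 : Measurable fun p : (Fin d → X × I) × (X × I) =>
      mmVal K F (insert p.2 (Set.range p.1)) := by
    have : Measurable fun p : (Fin d → X × I) × (X × I) =>
        (Fin.cons p.2 p.1 : Fin (d + 1) → X × I) := by
      refine measurable_pi_lambda _ fun i => ?_
      refine Fin.cases ?_ (fun i => ?_) i
      · simpa using measurable_snd
      · simpa [Function.comp_def] using (measurable_pi_apply i).comp measurable_fst
    have := (m0 (Fin (d + 1))).comp this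
    simpa only [Function.comp_def, Fin.range_cons] using this
  have m3 : ∀ i, Measurable fun p : (Fin d → X × I) × (X × I) => mmVal K F (p.1 '' {i}ᶜ) :=
    fun i => (measurable_mmVal_image h hF _).comp measurable_fst
  have : paddedViolation K F d =
      {p | mmVal K F (Set.range p.1) < mmVal K F (insert p.2 (Set.range p.1))} ∪
      ⋃ i, ({p | mmVal K F (p.1 '' {i}ᶜ) = mmVal K F (Set.range p.1)} ∩
        {p | (p.1 i).2 < p.2.2}) := by
    ext p
    simp [paddedViolation]
  rw [this]
  refine (measurableSet_lt m1 m2).union (MeasurableSet.iUnion fun i => ?_)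
  exact (measurableSet_eq_fun (m3 i) m1).inter
    (measurableSet_lt (measurable_snd.comp ((measurable_pi_apply i).comp measurable_fst))
      (measurable_snd.comp measurable_snd))

/-- Raising the mark of `i` to a level where `i` is essential for `A'` strictly raises the value of
`A'` (`mmVal_insert_lt`) and leaves that of `A` alone, so at most one mark produces a tie. -/
theorem ae_nondegenerate (h : IsMinMaxProgram K F) (hF : ∀ Ψ ∈ K, Continuous (F Ψ))
    (hu : ∀ Ψ ∈ K, ∀ x, StrictMono fun u => F Ψ (x, u)) (P : Measure X) [IsProbabilityMeasure P]
    (M : ℕ) : ∀ᵐ y ∂(Measure.pi fun _ : Fin M => P.prod (volume : Measure I)),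
      ∀ (A A' : Finset (Fin M)) (i : Fin M), i ∈ A' → i ∉ A →
        mmVal K F (y '' (A'.erase i)) < mmVal K F (y '' A') →
        mmVal K F (y '' A) ≠ mmVal K F (y '' A') := by
  classical
  rw [ae_all_iff]; intro A
  rw [ae_all_iff]; intro A'
  rw [ae_all_iff]; intro i
  by_cases hi : i ∈ A'
  swap
  · simp [hi]
  by_cases hiA : i ∈ A
  · simp [hiA]
  have hm : ∀ B : Finset (Fin M), Measurable fun y : Fin M → X × I => mmVal K F (y '' B) :=
    fun B => measurable_mmVal_image h hF _
  have key := ae_of_mark_unique P i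
    (s := {y : Fin M → X × I | mmVal K F (y '' (A'.erase i)) < mmVal K F (y '' A')} ∩
      {y | mmVal K F (y '' A) = mmVal K F (y '' A')})
    ((measurableSet_lt (hm _) (hm _)).inter (measurableSet_eq_fun (hm _) (hm _))) (by
      intro y x u₁ u₂ hlt h₁ h₂
      have himg : ∀ (B : Finset (Fin M)), i ∉ B → ∀ p, Function.update y i p '' B = y '' B := by
        intro B hB p
        refine Set.image_congr fun j hj => Function.update_of_ne ?_ _ _
        rintro rfl
        exact hB hj
      have hins : ∀ p, Function.update y i p '' A' = insert p (y '' (A'.erase i)) := by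
        intro p
        rw [← himg (A'.erase i) (Finset.notMem_erase i A') p]
        conv_lhs => rw [← Finset.insert_erase hi]
        rw [Finset.coe_insert, Set.image_insert_eq, Function.update_self]
      simp only [Set.mem_inter_iff, Set.mem_ofPred_eq, hins, himg A hiA,
        himg _ (Finset.notMem_erase i A')] at h₁ h₂
      have := h.mmVal_insert_lt ((A'.erase i).finite_toSet.image y)
        (fun Ψ hΨ => hu Ψ hΨ x hlt) h₂.1
      exact this.ne (h₁.2.symm.trans h₂.2))
  rw [ae_iff]
  refine measure_mono_null (fun y hy => ?_) key
  simp only [Set.mem_ofPred_eq, hi, hiA, not_false_eq_true, forall_const] at hy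
  push Not at hy
  exact hy

variable [FiniteDimensional ℝ E]

theorem ae_existsUnique_supportedOn (h : IsMinMaxProgram K F) (hF : ∀ Ψ ∈ K, Continuous (F Ψ))
    (hu : ∀ Ψ ∈ K, ∀ x, StrictMono fun u => F Ψ (x, u)) (P : Measure X) [IsProbabilityMeasure P]
    {d : ℕ} (hd : d = Module.finrank ℝ E + 1) {M : ℕ} (hM : d ≤ M) :
    ∀ᵐ y ∂(Measure.pi fun _ : Fin M => P.prod (volume : Measure I)),
      (∃! S, SupportedOn (paddedViolation K F d) y S) := by
  classical
  filter_upwards [ae_nondegenerate h hF hu P M, ae_injective_marks P M] with y hy hy'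
  simp_rw [supportedOn_paddedViolation_iff]
  refine existsUnique_support (fun A : Finset (Fin M) => mmVal K F (y '' A))
    (fun A B hAB => mmVal_mono (Set.image_mono (by exact_mod_cast hAB))) ?_ ?_ hy hy' (by simpa)
  · intro S hS
    -- Locality needs a nonempty set: the empty one has value `⊥`, and adding index `0` (available
    -- as `1 ≤ d ≤ M`) raises it.
    have hne : S.Nonempty := by
      by_contra hcon
      rw [Finset.not_nonempty_iff_eq_empty] at hcon
      subst hcon
      have := hS ⟨0, by omega⟩
      have h2 := bot_lt_mmVal h.isCompact h.nonempty h.continuousOn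
        (Z := y '' (insert ⟨0, by omega⟩ ∅ : Finset (Fin M))) (by simp)
      rw [this] at h2
      obtain ⟨Ψ, hΨ⟩ := h.nonempty
      exact absurd (mmVal_le hΨ (F := F) (Z := y '' (∅ : Finset (Fin M))) (c := ⊥) (by simp))
        (not_le.2 h2)
    refine h.mmVal_eq_of_forall_insert (S.finite_toSet.image y)
      ((Finset.coe_nonempty.2 hne).image y) (Set.image_mono (by simp)) ?_
    rintro _ ⟨j, _, rfl⟩
    rw [← Set.image_insert_eq, ← Finset.coe_insert]
    exact (hS j).le
  · obtain ⟨B, _, hB, hB'⟩ := h.exists_small_basis Finset.univ y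
    exact ⟨B, hd ▸ hB, hB'⟩

/-- The exact bound on the violation probability of the solution of a random convex program. -/
theorem measure_violation_le (h : IsMinMaxProgram K F) (hF : ∀ Ψ ∈ K, Continuous (F Ψ))
    (hu : ∀ Ψ ∈ K, ∀ x, StrictMono fun u => F Ψ (x, u)) (P : Measure X) [IsProbabilityMeasure P]
    {d : ℕ} (hd : d = Module.finrank ℝ E + 1) {N : ℕ} (hN : d ≤ N) {e : ℝ} (he0 : 0 ≤ e)
    (he1 : e ≤ 1) :
    (Measure.pi fun _ : Fin N => P.prod (volume : Measure I)) {y | ∃ Ψ ∈ K, ∃ c : ℝ,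
      (∀ i, F Ψ (y i) ≤ c) ∧ (∀ Ψ' ∈ K, ∃ i, c ≤ F Ψ' (y i)) ∧
      ENNReal.ofReal e ≤ P.prod (volume : Measure I) {p | c < F Ψ p}} ≤
    ENNReal.ofReal (binTail d N e) := by
  refine le_trans (measure_mono_ae ?_) (measure_supportedOn_violation_le
    (P.prod (volume : Measure I)) (by omega) (measurableSet_paddedViolation h hF d)
    (fun M hM => ae_existsUnique_supportedOn h hF hu P hd hM) hN he0 he1)
  filter_upwards [ae_existsUnique_supportedOn h hF hu P hd hN] with y hy
  rintro ⟨Ψ, hΨ, c, hc, hopt, he⟩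
  obtain ⟨S, hS, -⟩ := hy
  refine ⟨S, hS, he.trans (measure_mono fun p hp => .inl ?_)⟩
  have hne : (y '' S.1).Nonempty := by
    refine (Finset.coe_nonempty.2 (Finset.card_pos.1 ?_)).image y
    have := S.2
    omega
  have hfin := S.1.finite_toSet.image y
  have hval : mmVal K F (y '' S.1) = mmVal K F (Set.range y) := by
    refine h.mmVal_eq_of_forall_insert hfin hne (Set.image_subset_range _ _) ?_
    rintro _ ⟨j, rfl⟩
    by_cases hj : j ∈ S.1
    · rw [Set.insert_eq_of_mem (Set.mem_image_of_mem y hj)]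
    · have := (supportedOn_paddedViolation_iff y S).1 hS j hj
      rw [not_or, not_lt, Finset.coe_insert, Set.image_insert_eq] at this
      exact this.1
  have hle : ∀ y' ∈ Set.range y, (F Ψ y' : EReal) ≤ c := by
    rintro _ ⟨i, rfl⟩
    exact EReal.coe_le_coe_iff.2 (hc i)
  have hcval : mmVal K F (Set.range y) = c := by
    refine le_antisymm (mmVal_le hΨ hle) ?_
    obtain ⟨Ψ', hΨ', h'⟩ := exists_argmin h.isCompact h.nonempty h.continuousOn (Set.range y)
    obtain ⟨i, hi⟩ := hopt Ψ' hΨ'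
    exact (EReal.coe_le_coe_iff.2 hi).trans (h' _ ⟨i, rfl⟩)
  -- The support set has the value of the whole sample, so `Ψ` is also its unique minimizer; by
  -- locality a point with `c < F Ψ p` must raise that value.
  show mmVal K F (Set.range (subsample y S)) < mmVal K F (insert p (Set.range (subsample y S)))
  rw [image_subsample]
  by_contra hcon
  have := h.le_of_mmVal_insert_le hfin hne (not_lt.1 hcon) hΨ fun y' hy' => by
    rw [hval, hcval]
    exact hle y' (Set.image_subset_range _ _ hy')
  rw [hval, hcval] at this
  exact not_lt.2 (EReal.coe_le_coe_iff.1 this) hp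

end MarkedProgram

/-! ### Removing the perturbation -/

/-- Fatou's lemma for sets: `s` lies in the increasing union of the tail intersections. No
measurability is needed. -/
theorem measure_le_of_forall_eventually_mem {Ω : Type*} [MeasurableSpace Ω] (μ : Measure Ω)
    {s : Set Ω} {B : ℕ → Set Ω} {c : ℝ≥0∞} (hs : ∀ x ∈ s, ∀ᶠ n in Filter.atTop, x ∈ B n)
    (hB : ∀ n, μ (B n) ≤ c) : μ s ≤ c := by
  have hsub : s ⊆ ⋃ m, ⋂ n, ⋂ (_ : m ≤ n), B n := by
    intro x hx
    obtain ⟨m, hm⟩ := Filter.eventually_atTop.1 (hs x hx)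
    exact Set.mem_iUnion.2 ⟨m, Set.mem_iInter₂.2 hm⟩
  have hmono : Monotone fun m => ⋂ n, ⋂ (_ : m ≤ n), B n := by
    intro m m' h x hx
    rw [Set.mem_iInter₂] at hx ⊢
    exact fun n hn => hx n (h.trans hn)
  refine (measure_mono hsub).trans ?_
  rw [hmono.measure_iUnion]
  exact iSup_le fun m => (measure_mono (Set.iInter₂_subset m le_rfl)).trans (hB m)

theorem IsMinMaxProgram.exists_optimal {E Y : Type*} [NormedAddCommGroup E] [NormedSpace ℝ E]
    {K : Set E} {F : E → Y → ℝ} (h : IsMinMaxProgram K F) {ι : Type*} [Finite ι] [Nonempty ι]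
    (y : ι → Y) :
    ∃ Ψ ∈ K, ∃ c : ℝ, (∀ i, F Ψ (y i) ≤ c) ∧ ∀ Ψ' ∈ K, ∃ i, c ≤ F Ψ' (y i) := by
  obtain ⟨Ψ, hΨ, h₁⟩ := exists_argmin h.isCompact h.nonempty h.continuousOn (Set.range y)
  obtain ⟨c, hc⟩ := exists_coe_eq_mmVal h.isCompact h.nonempty h.continuousOn
    (Set.finite_range y) (Set.range_nonempty y)
  rw [hc] at h₁
  refine ⟨Ψ, hΨ, c, fun i => EReal.coe_le_coe_iff.1 (h₁ _ ⟨i, rfl⟩), fun Ψ' hΨ' => ?_⟩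
  by_contra hcon
  push Not at hcon
  have : mmVal K F (Set.range y) < c := by
    refine mmVal_lt (Set.finite_range y) (EReal.bot_lt_coe c) hΨ' ?_
    rintro _ ⟨i, rfl⟩
    exact EReal.coe_lt_coe_iff.2 (hcon i)
  exact this.ne hc

section Regularization

open unitInterval Filter Topology

variable {X E : Type*}

/-- The constraint function `f`, perturbed by a tie-breaking function, a strictly convex function
and the mark of the sample. -/
def regularized (f : E → X → ℝ) (τ κ : E → ℝ) (δ : ℝ) (Ψ : E) (p : X × I) : ℝ :=
  f Ψ p.1 + δ * τ Ψ + δ ^ 2 * (κ Ψ + p.2)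

variable [NormedAddCommGroup E] [NormedSpace ℝ E] {K : Set E} {f : E → X → ℝ} {τ κ : E → ℝ}

theorem isMinMaxProgram_regularized (hK : IsCompact K) (hne : K.Nonempty)
    (hf : ∀ x, ConvexOn ℝ K fun Ψ => f Ψ x) (hfc : ∀ x, ContinuousOn (fun Ψ => f Ψ x) K)
    (hτ : ConvexOn ℝ K τ) (hτc : ContinuousOn τ K) (hκ : StrictConvexOn ℝ K κ)
    (hκc : ContinuousOn κ K) {δ : ℝ} (hδ : 0 < δ) :
    IsMinMaxProgram K (regularized f τ κ δ) where
  isCompact := hK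
  nonempty := hne
  continuousOn p :=
    ((hfc p.1).add (hτc.const_smul δ)).add ((hκc.add continuousOn_const).const_smul (δ ^ 2))
  strictConvexOn p := by
    refine ⟨hτ.1, fun Ψ hΨ Ψ' hΨ' hne a b ha hb hab => ?_⟩
    have h1 := (hf p.1).2 hΨ hΨ' ha.le hb.le hab
    have h2 := hτ.2 hΨ hΨ' ha.le hb.le hab
    have h3 := hκ.2 hΨ hΨ' hne ha hb hab
    simp only [smul_eq_mul, regularized] at *
    have h4 := mul_le_mul_of_nonneg_left h2 hδ.le
    have h5 := mul_lt_mul_of_pos_left h3 (pow_pos hδ 2)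
    have h6 : (p.2 : ℝ) = a * p.2 + b * p.2 := by rw [← add_mul, hab, one_mul]
    calc _ < (a * f Ψ p.1 + b * f Ψ' p.1) + δ * (a * τ Ψ + b * τ Ψ') +
          (δ ^ 2 * (a * κ Ψ + b * κ Ψ') + δ ^ 2 * p.2) := by linarith
      _ = _ := by
        nth_rewrite 1 [h6]
        ring
  convex := hτ.1

variable [MeasurableSpace X]

/-- Optimal solutions of regularized programs accumulate at preferred solutions, and the
violation probability is lower semicontinuous. -/
theorem eventually_regularized_violation (P : Measure X) [IsProbabilityMeasure P]
    (hK : IsCompact K) (hne : K.Nonempty)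
    (hf : ∀ x, ConvexOn ℝ K fun Ψ => f Ψ x) (hfc : ∀ x, ContinuousOn (fun Ψ => f Ψ x) K)
    (hτ : ConvexOn ℝ K τ) (hτc : ContinuousOn τ K) (hκ : StrictConvexOn ℝ K κ)
    (hκc : ContinuousOn κ K) {N : ℕ} (hN : 0 < N) {e e' : ℝ≥0∞} (hee : e < e') (ω : Fin N → X)
    (u : Fin N → I) {Ψ₀ : E} (hΨ₀ : Ψ₀ ∈ K) {μ : ℝ} (h₀ : ∀ i, f Ψ₀ (ω i) ≤ μ)
    (hopt : ∀ Ψ ∈ K, ∃ i, μ ≤ f Ψ (ω i))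
    (hviol : ∀ Ψ ∈ K, (∀ i, f Ψ (ω i) ≤ μ) → τ Ψ ≤ τ Ψ₀ → e' ≤ P {x | μ < f Ψ x}) :
    ∀ᶠ n : ℕ in atTop, ∃ Ψ ∈ K, ∃ c : ℝ,
      (∀ i, regularized f τ κ (1 / ((n : ℝ) + 1)) Ψ (ω i, u i) ≤ c) ∧
      (∀ Ψ' ∈ K, ∃ i, c ≤ regularized f τ κ (1 / ((n : ℝ) + 1)) Ψ' (ω i, u i)) ∧
      e ≤ P.prod (volume : Measure I) {p | c < regularized f τ κ (1 / ((n : ℝ) + 1)) Ψ p} := by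
  have : Nonempty (Fin N) := ⟨⟨0, hN⟩⟩
  by_contra hcon
  obtain ⟨φ, hφ, hφ'⟩ := extraction_of_frequently_atTop (not_eventually.1 hcon)
  have hδ : ∀ n : ℕ, (0 : ℝ) < 1 / ((n : ℝ) + 1) := fun n => by positivity
  have hδ1 : ∀ n : ℕ, 1 / ((n : ℝ) + 1) ≤ 1 := fun n => by
    rw [div_le_one (by positivity)]
    linarith [(Nat.cast_nonneg n : (0 : ℝ) ≤ n)]
  choose Ψs hΨs cs hcs hopts using fun n : ℕ =>
    (isMinMaxProgram_regularized hK hne hf hfc hτ hτc hκ hκc (hδ n)).exists_optimal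
      fun i => (ω i, u i)
  -- Along the indices where the claim fails, the perturbed optima have violation at most `e`; by
  -- compactness a subsequence converges.
  obtain ⟨Ψ', hΨ', ψ, hψ, hlim⟩ := hK.tendsto_subseq fun k => hΨs (φ k)
  have hsmall : ∀ k, P.prod (volume : Measure I)
      {p | cs (φ (ψ k)) < regularized f τ κ (1 / ((φ (ψ k) : ℝ) + 1)) (Ψs (φ (ψ k))) p} ≤ e := by
    intro k
    by_contra hk
    exact hφ' (ψ k) ⟨_, hΨs _, _, hcs _, hopts _, (not_le.1 hk).le⟩
  obtain ⟨Cτ, hCτ⟩ := hK.exists_bound_of_continuousOn hτc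
  obtain ⟨Cκ, hCκ⟩ := hK.exists_bound_of_continuousOn hκc
  simp only [Real.norm_eq_abs, abs_le] at hCτ hCκ
  set δ : ℕ → ℝ := fun k => 1 / ((φ (ψ k) : ℝ) + 1) with hδdef
  have hδ0 : ∀ k, 0 < δ k := fun k => hδ _
  have hδlim : Tendsto δ atTop (𝓝 0) :=
    tendsto_one_div_add_atTop_nhds_zero_nat.comp (hφ.comp hψ).tendsto_atTop
  have hup : ∀ k, cs (φ (ψ k)) ≤ μ + δ k * τ Ψ₀ + δ k ^ 2 * (Cκ + 1) := by
    intro k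
    obtain ⟨i, hi⟩ := hopts (φ (ψ k)) Ψ₀ hΨ₀
    refine hi.trans ?_
    simp only [regularized]
    have h1 := h₀ i
    have h2 : κ Ψ₀ + (u i : ℝ) ≤ Cκ + 1 := add_le_add (hCκ _ hΨ₀).2 (u i).2.2
    have h3 := mul_le_mul_of_nonneg_left h2 (sq_nonneg (δ k))
    simp only [hδdef] at h3 ⊢
    linarith
  have hlow : ∀ k (p : X × I), f (Ψs (φ (ψ k))) p.1 + δ k * τ (Ψs (φ (ψ k))) - δ k ^ 2 * Cκ ≤
      regularized f τ κ (1 / ((φ (ψ k) : ℝ) + 1)) (Ψs (φ (ψ k))) p := by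
    intro k p
    simp only [regularized]
    have h2 : -Cκ ≤ κ (Ψs (φ (ψ k))) + (p.2 : ℝ) := by
      linarith [(hCκ _ (hΨs (φ (ψ k)))).1, p.2.2.1]
    have h3 := mul_le_mul_of_nonneg_left h2 (sq_nonneg (δ k))
    simp only [hδdef] at h3 ⊢
    linarith
  have hfk : ∀ x, Tendsto (fun k => f (Ψs (φ (ψ k))) x) atTop (𝓝 (f Ψ' x)) := fun x =>
    (hfc x Ψ' hΨ').tendsto.comp (tendsto_nhdsWithin_iff.2 ⟨hlim, .of_forall fun k => hΨs _⟩)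
  have hτk : Tendsto (fun k => τ (Ψs (φ (ψ k)))) atTop (𝓝 (τ Ψ')) :=
    (hτc Ψ' hΨ').tendsto.comp (tendsto_nhdsWithin_iff.2 ⟨hlim, .of_forall fun k => hΨs _⟩)
  -- The order-one terms cancel because every `Ψ` in `K` has some sample with `f ≥ μ`; dividing what
  -- remains by `δ` leaves an error of order `δ`.
  have hτle : τ Ψ' ≤ τ Ψ₀ := by
    have hle : ∀ k, τ (Ψs (φ (ψ k))) ≤ τ Ψ₀ + δ k * (2 * Cκ + 1) := by
      intro k
      obtain ⟨i, hi⟩ := hopt _ (hΨs (φ (ψ k)))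
      have h1 := (hlow k (ω i, u i)).trans (hcs _ i)
      have h2 := hup k
      refine le_of_mul_le_mul_left ?_ (hδ0 k)
      simp only at h1
      nlinarith
    have hl : Tendsto (fun k => τ Ψ₀ + δ k * (2 * Cκ + 1)) atTop (𝓝 (τ Ψ₀)) := by
      simpa using (hδlim.mul_const (2 * Cκ + 1)).const_add (τ Ψ₀)
    exact le_of_tendsto_of_tendsto' hτk hl hle
  have herr : Tendsto (fun k => δ k * τ Ψ₀ + δ k ^ 2 * (Cκ + 1) - δ k * τ (Ψs (φ (ψ k))) +
      δ k ^ 2 * Cκ) atTop (𝓝 0) := by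
    have := (((hδlim.mul_const (τ Ψ₀)).add ((hδlim.pow 2).mul_const (Cκ + 1))).sub
      (hδlim.mul hτk)).add ((hδlim.pow 2).mul_const Cκ)
    simpa using this
  have hfeas : ∀ i, f Ψ' (ω i) ≤ μ := by
    intro i
    have hl : Tendsto (fun k => μ + (δ k * τ Ψ₀ + δ k ^ 2 * (Cκ + 1) -
        δ k * τ (Ψs (φ (ψ k))) + δ k ^ 2 * Cκ)) atTop (𝓝 μ) := by
      simpa using herr.const_add μ
    refine le_of_tendsto_of_tendsto' (hfk (ω i)) hl fun k => ?_
    have h1 := (hlow k (ω i, u i)).trans (hcs _ i)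
    have h2 := hup k
    simp only at h1
    linarith
  have h1 := hviol Ψ' hΨ' hfeas hτle
  -- A point violating the limit `Ψ'` eventually violates the perturbed optima, so the limit has
  -- violation at most `e < e'`.
  have h2 : P.prod (volume : Measure I) ({x | μ < f Ψ' x} ×ˢ Set.univ) ≤ e := by
    refine measure_le_of_forall_eventually_mem _ ?_ hsmall
    rintro p ⟨hp, -⟩
    have hl := (hfk p.1).sub herr
    rw [sub_zero] at hl
    filter_upwards [hl.eventually (lt_mem_nhds hp)] with k hk
    have h3 := hlow k p
    have h4 := hup k
    show cs (φ (ψ k)) < _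
    linarith
  rw [Measure.prod_prod, measure_univ, mul_one] at h2
  exact not_lt.2 (h1.trans h2) hee

variable [TopologicalSpace X] [SecondCountableTopology X] [BorelSpace X] [FiniteDimensional ℝ E]

/-- The exact violation bound for convex programs over a compact set whose solutions need not be
unique: with high probability some preferred solution has a small violation probability. -/
theorem measure_preferred_violation_le (P : Measure X) [IsProbabilityMeasure P]
    (hK : IsCompact K) (hf : ∀ x, ConvexOn ℝ K fun Ψ => f Ψ x)
    (hfc : ∀ x, ContinuousOn (fun Ψ => f Ψ x) K) (hfx : ∀ Ψ ∈ K, Continuous (f Ψ))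
    (hτ : ConvexOn ℝ K τ) (hτc : ContinuousOn τ K) (hκ : StrictConvexOn ℝ K κ)
    (hκc : ContinuousOn κ K) {d : ℕ} (hd : d = Module.finrank ℝ E + 1) {N : ℕ} (hN : d ≤ N)
    {e' : ℝ} (he0 : 0 < e') (he1 : e' ≤ 1) :
    (Measure.pi fun _ : Fin N => P) {ω | ∃ Ψ₀ ∈ K, ∃ μ : ℝ, (∀ i, f Ψ₀ (ω i) ≤ μ) ∧
      (∀ Ψ ∈ K, ∃ i, μ ≤ f Ψ (ω i)) ∧
      ∀ Ψ ∈ K, (∀ i, f Ψ (ω i) ≤ μ) → τ Ψ ≤ τ Ψ₀ → ENNReal.ofReal e' ≤ P {x | μ < f Ψ x}} ≤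
    ENNReal.ofReal (binTail d N e') := by
  rcases K.eq_empty_or_nonempty with rfl | hne
  · simp
  set bad := {ω : Fin N → X | ∃ Ψ₀ ∈ K, ∃ μ : ℝ, (∀ i, f Ψ₀ (ω i) ≤ μ) ∧
      (∀ Ψ ∈ K, ∃ i, μ ≤ f Ψ (ω i)) ∧
      ∀ Ψ ∈ K, (∀ i, f Ψ (ω i) ≤ μ) → τ Ψ ≤ τ Ψ₀ → ENNReal.ofReal e' ≤ P {x | μ < f Ψ x}}
  -- The limit argument needs a strict gap `e < e'`; continuity of the binomial tail closes it
  -- afterwards.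
  have hlt : ∀ e ∈ Set.Ioo 0 e', (Measure.pi fun _ : Fin N => P) bad ≤
      ENNReal.ofReal (binTail d N e) := by
    rintro e ⟨h0, h1⟩
    have hee : ENNReal.ofReal e < ENNReal.ofReal e' := (ENNReal.ofReal_lt_ofReal_iff he0).2 h1
    have hpres := measurePreserving_arrowProdEquivProdArrow X I (Fin N) (fun _ => P)
      (fun _ => (volume : Measure I))
    have hbad : (Measure.pi fun _ : Fin N => P) bad =
        (Measure.pi fun _ : Fin N => P.prod (volume : Measure I))
          (MeasurableEquiv.arrowProdEquivProdArrow X I (Fin N) ⁻¹' (bad ×ˢ Set.univ)) := by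
      rw [hpres.measure_preimage_equiv, Measure.prod_prod, measure_univ, mul_one]
    rw [hbad]
    refine measure_le_of_forall_eventually_mem _ ?_ fun n : ℕ =>
      measure_violation_le (isMinMaxProgram_regularized hK hne hf hfc hτ hτc hκ hκc
        (by positivity : (0 : ℝ) < 1 / ((n : ℝ) + 1))) ?_ ?_ P hd hN h0.le (h1.le.trans he1)
    · rintro y ⟨⟨Ψ₀, hΨ₀, μ, h₀, hopt, hviol⟩, -⟩
      exact eventually_regularized_violation P hK hne hf hfc hτ hτc hκ hκc (by omega) hee
        (fun i => (y i).1) (fun i => (y i).2) hΨ₀ h₀ hopt hviol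
    · intro Ψ hΨ
      have := hfx Ψ hΨ
      unfold regularized
      fun_prop
    · intro Ψ _ x u₁ u₂ hu
      have hu' : (u₁ : ℝ) < u₂ := hu
      have hpos : (0 : ℝ) < (1 / ((n : ℝ) + 1)) ^ 2 := by positivity
      simp only [regularized]
      have := mul_lt_mul_of_pos_left hu' hpos
      linarith
  refine ge_of_tendsto (x := 𝓝[<] e') ?_ (Filter.eventually_of_mem (Ioo_mem_nhdsLT he0) hlt)
  exact (ENNReal.continuous_ofReal.comp (continuous_binTail d N)).continuousWithinAt.tendsto

end Regularization

/-! ### The parameter space and its compact truncations -/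

namespace Param

variable {z : ℕ}

/-- The squared Euclidean norm of the decision variables. -/
def normSq (Ψ : Param z) : ℝ := Ψ.1 ^ 2 + Ψ.2.1 ^ 2 + ∑ j, Ψ.2.2 j ^ 2

theorem continuous_normSq : Continuous (normSq : Param z → ℝ) := by
  unfold normSq
  fun_prop

/-- The product type carries a sup norm, which is not strictly convex; the sum of squares has
convexity defect exactly `a b |Ψ - Ψ'|²`. -/
theorem strictConvexOn_normSq : StrictConvexOn ℝ Set.univ (normSq : Param z → ℝ) := by
  refine ⟨convex_univ, fun Ψ _ Ψ' _ hne a b ha hb hab => ?_⟩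
  have hpos : 0 < normSq (Ψ - Ψ') := by
    have h0 : ∀ j, 0 ≤ (Ψ - Ψ').2.2 j ^ 2 := fun j => sq_nonneg _
    by_contra hcon
    apply hne
    have h1 := sq_nonneg (Ψ - Ψ').1
    have h2 := sq_nonneg (Ψ - Ψ').2.1
    have h3 := Finset.sum_nonneg fun j (_ : j ∈ Finset.univ) => h0 j
    unfold normSq at hcon
    have h4 : (Ψ - Ψ').1 ^ 2 = 0 := by linarith
    have h5 : (Ψ - Ψ').2.1 ^ 2 = 0 := by linarith
    have h6 : ∑ j, (Ψ - Ψ').2.2 j ^ 2 = 0 := by linarith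
    rw [Finset.sum_eq_zero_iff_of_nonneg fun j _ => h0 j] at h6
    rw [← sub_eq_zero]
    refine Prod.ext (pow_eq_zero_iff two_ne_zero |>.1 h4)
      (Prod.ext (pow_eq_zero_iff two_ne_zero |>.1 h5) (funext fun j => ?_))
    exact pow_eq_zero_iff two_ne_zero |>.1 (h6 j (Finset.mem_univ j))
  have hid : normSq (a • Ψ + b • Ψ') + a * b * normSq (Ψ - Ψ') =
      a • normSq Ψ + b • normSq Ψ' := by
    obtain rfl : b = 1 - a := by linarith
    have hs : ∑ j, (a * Ψ.2.2 j + (1 - a) * Ψ'.2.2 j) ^ 2 +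
        a * (1 - a) * ∑ j, (Ψ.2.2 j - Ψ'.2.2 j) ^ 2 =
        a * ∑ j, Ψ.2.2 j ^ 2 + (1 - a) * ∑ j, Ψ'.2.2 j ^ 2 := by
      simp only [Finset.mul_sum, ← Finset.sum_add_distrib]
      exact Finset.sum_congr rfl fun j _ => by ring
    simp only [normSq, Prod.fst_add, Prod.snd_add, Prod.smul_fst, Prod.smul_snd, Pi.add_apply,
      Pi.smul_apply, Prod.fst_sub, Prod.snd_sub, Pi.sub_apply, smul_eq_mul]
    linear_combination hs
  have := mul_pos (mul_pos ha hb) hpos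
  linarith

theorem finrank_eq : Module.finrank ℝ (Param z) = z + 2 := by
  simp only [Param, Module.finrank_prod, Module.finrank_self, Module.finrank_fin_fun]
  omega

/-- Admissible parameters that are bounded and bounded away from `σ = 0`. -/
def truncation (Θ : Set (Param z)) (R : ℕ) : Set (Param z) :=
  {Ψ | Ψ ∈ Θ ∧ 1 / ((R : ℝ) + 1) ≤ Ψ.sig ∧ 0 ≤ Ψ.rho ∧ ‖Ψ‖ ≤ R}

theorem admissible_of_mem_truncation {Θ : Set (Param z)} {R : ℕ} {Ψ : Param z}
    (h : Ψ ∈ truncation Θ R) : Admissible Θ Ψ :=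
  ⟨h.1, lt_of_lt_of_le (by positivity) h.2.1, h.2.2.1⟩

theorem eventually_mem_truncation {Θ : Set (Param z)} {Ψ : Param z} (h : Admissible Θ Ψ) :
    ∀ᶠ R : ℕ in Filter.atTop, Ψ ∈ truncation Θ R := by
  have h1 := (tendsto_one_div_add_atTop_nhds_zero_nat (𝕜 := ℝ)).eventually (gt_mem_nhds h.2.1)
  filter_upwards [h1, Filter.eventually_ge_atTop ⌈‖Ψ‖⌉₊] with R h1 h2
  exact ⟨h.1, h1.le, h.2.2, (Nat.le_ceil _).trans (by exact_mod_cast h2)⟩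

theorem truncation_eq (Θ : Set (Param z)) (R : ℕ) : truncation Θ R =
    Θ ∩ ({Ψ | 1 / ((R : ℝ) + 1) ≤ Ψ.sig} ∩ {Ψ | 0 ≤ Ψ.rho}) ∩ Metric.closedBall 0 (R : ℝ) := by
  ext Ψ
  rw [Set.mem_inter_iff, mem_closedBall_zero_iff]
  exact ⟨fun h => ⟨⟨h.1, h.2.1, h.2.2.1⟩, h.2.2.2⟩,
    fun h => ⟨h.1.1, h.1.2.1, h.1.2.2, h.2⟩⟩

theorem isCompact_truncation {Θ : Set (Param z)} (hΘ : IsClosed Θ) (R : ℕ) :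
    IsCompact (truncation Θ R) := by
  have h1 : IsClosed {Ψ : Param z | 1 / ((R : ℝ) + 1) ≤ Ψ.sig} :=
    isClosed_le continuous_const (by unfold sig; fun_prop)
  have h2 : IsClosed {Ψ : Param z | 0 ≤ Ψ.rho} :=
    isClosed_le continuous_const (by unfold rho; fun_prop)
  rw [truncation_eq]
  exact (isCompact_closedBall (0 : Param z) (R : ℝ)).inter_left (hΘ.inter (h1.inter h2))

theorem convex_truncation {Θ : Set (Param z)} (hΘ : Convex ℝ Θ) (R : ℕ) :
    Convex ℝ (truncation Θ R) := by
  have h1 : Convex ℝ {Ψ : Param z | 1 / ((R : ℝ) + 1) ≤ Ψ.sig} :=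
    convex_halfSpace_ge (LinearMap.fst ℝ ℝ (ℝ × (Fin z → ℝ))).isLinear _
  have h2 : Convex ℝ {Ψ : Param z | 0 ≤ Ψ.rho} :=
    convex_halfSpace_ge ((LinearMap.fst ℝ ℝ (Fin z → ℝ)).comp
      (LinearMap.snd ℝ ℝ (ℝ × (Fin z → ℝ)))).isLinear _
  rw [truncation_eq]
  exact (hΘ.inter (h1.inter h2)).inter (convex_closedBall (0 : Param z) (R : ℝ))

end Param

/-! ### Convexity of the constraints and the ABF property -/

section System

variable {n p z : ℕ} (S : DtDCS n p) (π : StatePartition S.X)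
    (q : Fin z → S.X → π.absStates → ℝ)

theorem candV_combo (a b : ℝ) (η η' : Fin z → ℝ) (x : S.X) (xh : π.absStates) :
    candV S π q (a • η + b • η') x xh = a * candV S π q η x xh + b * candV S π q η' x xh := by
  simp only [candV, Finset.mul_sum, ← Finset.sum_add_distrib, Pi.add_apply, Pi.smul_apply,
    smul_eq_mul]
  exact Finset.sum_congr rfl fun j _ => by ring

theorem continuous_candV (x : S.X) (xh : π.absStates) :
    Continuous fun Ψ : Param z => candV S π q Ψ.eta x xh := by
  unfold candV Param.eta
  fun_prop

theorem continuous_phi1 (x : S.X) (xh : π.absStates) :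
    Continuous fun Ψ : Param z => phi1 S π q Ψ x xh := by
  have := continuous_candV S π q x xh
  unfold phi1 Param.sig
  fun_prop

theorem continuous_phi2 (g : ℝ) (x : S.X) (xh : π.absStates) (ν : S.U) :
    Continuous fun Ψ : Param z => phi2 S π q g Ψ x xh ν := by
  have h1 := continuous_candV S π q x xh
  have h2 := continuous_candV S π q (S.f x ν) (S.symb π xh ν)
  unfold phi2 Param.rho
  fun_prop

theorem convexOn_phi1 (x : S.X) (xh : π.absStates) :
    ConvexOn ℝ Set.univ fun Ψ : Param z => phi1 S π q Ψ x xh := by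
  refine ⟨convex_univ, fun Ψ _ Ψ' _ a b _ _ _ => le_of_eq ?_⟩
  have := candV_combo S π q a b Ψ.eta Ψ'.eta x xh
  simp only [phi1, smul_eq_mul]
  rw [show (a • Ψ + b • Ψ').eta = a • Ψ.eta + b • Ψ'.eta from rfl, this,
    show (a • Ψ + b • Ψ').sig = a * Ψ.sig + b * Ψ'.sig from rfl]
  ring

theorem convexOn_phi2 (g : ℝ) (x : S.X) (xh : π.absStates) (ν : S.U) :
    ConvexOn ℝ Set.univ fun Ψ : Param z => phi2 S π q g Ψ x xh ν := by
  refine ⟨convex_univ, fun Ψ _ Ψ' _ a b _ _ _ => le_of_eq ?_⟩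
  simp only [phi2, smul_eq_mul]
  rw [show (a • Ψ + b • Ψ').eta = a • Ψ.eta + b • Ψ'.eta from rfl, candV_combo, candV_combo,
    show (a • Ψ + b • Ψ').rho = a * Ψ.rho + b * Ψ'.rho from rfl]
  ring

/-- The robust constraints imply that the candidate is an alternating bisimulation function. -/
theorem isABF_of_phi_nonpos {g : ℝ} (hg : 0 < g ∧ g < 1) {Ψ : Param z} (hσ : 0 < Ψ.sig)
    (hρ : 0 ≤ Ψ.rho) (h1 : ∀ x xh, phi1 S π q Ψ x xh ≤ 0)
    (h2 : ∀ x xh ν, phi2 S π q g Ψ x xh ν ≤ 0) : IsABF S π (candV S π q Ψ.eta) := by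
  have hlow : ∀ (x : S.X) (xh : π.absStates),
      Ψ.sig * ‖(x : EVec n) - ((xh : S.X) : EVec n)‖ ^ 2 ≤ candV S π q Ψ.eta x xh := by
    intro x xh
    have := h1 x xh
    unfold phi1 at this
    linarith
  -- Turning `g V + ρ̃` into a maximum: either half of the gap `1 - g` absorbs `ρ̃`, giving the
  -- factor `(1 + g) / 2`, or `V < 2 ρ̃ / (1 - g)` and the whole sum is below that constant.
  refine ⟨fun x xh => le_trans (by positivity) (hlow x xh), Ψ.sig, (1 + g) / 2,
    Ψ.rho * (2 / (1 - g)), hσ, by linarith, by linarith,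
    mul_nonneg hρ (div_nonneg zero_le_two (by linarith)), hlow, fun x xh ν => ?_⟩
  have h := h2 x xh ν
  unfold phi2 at h
  rw [le_max_iff]
  by_contra hcon
  push Not at hcon
  obtain ⟨ha, hb⟩ := hcon
  have h3 : 0 < 1 - g := by linarith
  have h4 : Ψ.rho * (2 / (1 - g)) * (1 - g) = 2 * Ψ.rho := by
    field_simp
  have h5 := mul_lt_mul_of_pos_right hb h3
  nlinarith

instance : Finite π.absStates := Set.finite_range π.rep

noncomputable instance : Fintype π.absStates := Fintype.ofFinite _

variable [Nonempty π.absStates] [Nonempty S.U]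

/-- The maximum of `φ₁` and `φ₂` over the abstract states and the inputs. -/
noncomputable def maxPhi (g : ℝ) (Ψ : Param z) (x : S.X) : ℝ :=
  Finset.univ.sup' Finset.univ_nonempty
    fun t : π.absStates × S.U => max (phi1 S π q Ψ x t.1) (phi2 S π q g Ψ x t.1 t.2)

theorem maxPhi_le_iff {g : ℝ} {Ψ : Param z} {x : S.X} {c : ℝ} :
    maxPhi S π q g Ψ x ≤ c ↔ ∀ xh ν, max (phi1 S π q Ψ x xh) (phi2 S π q g Ψ x xh ν) ≤ c := by
  simp [maxPhi, Finset.sup'_le_iff]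

theorem continuous_maxPhi_param (g : ℝ) (x : S.X) :
    Continuous fun Ψ : Param z => maxPhi S π q g Ψ x :=
  Continuous.finset_sup'_apply _ fun t _ =>
    (continuous_phi1 S π q x t.1).max (continuous_phi2 S π q g x t.1 t.2)

theorem convexOn_maxPhi (g : ℝ) (x : S.X) :
    ConvexOn ℝ Set.univ fun Ψ : Param z => maxPhi S π q g Ψ x := by
  refine ⟨convex_univ, fun Ψ _ Ψ' _ a b ha hb hab => ?_⟩
  refine (maxPhi_le_iff S π q).2 fun xh ν => ?_
  refine (((convexOn_phi1 S π q x xh).sup (convexOn_phi2 S π q g x xh ν)).2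
    (Set.mem_univ Ψ) (Set.mem_univ Ψ') ha hb hab).trans ?_
  have h1 := (maxPhi_le_iff S π q).1 (le_refl (maxPhi S π q g Ψ x)) xh ν
  have h2 := (maxPhi_le_iff S π q).1 (le_refl (maxPhi S π q g Ψ' x)) xh ν
  exact add_le_add (mul_le_mul_of_nonneg_left h1 ha) (mul_le_mul_of_nonneg_left h2 hb)

theorem continuous_maxPhi_state {g : ℝ} {Ψ : Param z}
    (h1 : ∀ xh, Continuous fun x => phi1 S π q Ψ x xh)
    (h2 : ∀ xh ν, Continuous fun x => phi2 S π q g Ψ x xh ν) :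
    Continuous (maxPhi S π q g Ψ) :=
  Continuous.finset_sup'_apply _ fun t _ => (h1 t.1).max (h2 t.1 t.2)

end System

theorem mul_div_max_le {I J ε : ℝ} (hI : 0 ≤ I) (hε : 0 ≤ ε) : I * (ε / max I J) ≤ ε := by
  -- If both Lipschitz constants vanish, the radius is `ε / 0 = 0` and the bound still holds.
  rcases (le_max_of_le_left hI : 0 ≤ max I J).eq_or_lt with h | h
  · rw [← h, div_zero, mul_zero]
    exact hε
  · rw [mul_div_assoc', div_le_iff₀ h, mul_comm]
    exact mul_le_mul_of_nonneg_left (le_max_left _ _) hε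

theorem LipschitzWith.le_add_of_mem_closedBall {X : Type*} [PseudoMetricSpace X] {g : X → ℝ}
    {L : ℝ≥0} (hg : LipschitzWith L g) {x y : X} {r ε μ : ℝ} (hy : y ∈ Metric.closedBall x r)
    (hr : L * r ≤ ε) (hμ : g y ≤ μ) : g x ≤ μ + ε := by
  have h1 := hg.dist_le_mul x y
  rw [Real.dist_eq] at h1
  have h2 : dist x y ≤ r := by
    rw [dist_comm]
    exact hy
  have h3 := (le_abs_self _).trans (h1.trans (mul_le_mul_of_nonneg_left h2 L.2))
  have h4 : (L : ℝ) * r ≤ ε := hr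
  change g x - g y ≤ (L : ℝ) * r at h3
  linarith

/-! ### From violation probability to the ABF guarantee -/

section Scenario

variable {n p z l : ℕ} (S : DtDCS n p) (π : StatePartition S.X)
    (q : Fin z → S.X → π.absStates → ℝ) {Θ : Set (Param z)}

/-- A scenario solution whose violation probability is smaller than the measure of the balls of
radius `ε / max I₁ I₂` is robustly feasible, up to `ε`. -/
theorem isABF_of_violation_lt [Nonempty π.absStates] [Nonempty S.U] {g : ℝ} (hg : 0 < g ∧ g < 1)
    {I₁ I₂ : ℝ≥0} {ε : ℝ} (hε : 0 ≤ ε) {e : ℝ≥0∞} (P : Measure S.X)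
    (hP : ∀ x : S.X, e ≤ P (Metric.closedBall x (ε / max (I₁ : ℝ) I₂)))
    {Ψ : Param z} (hΨ : Admissible Θ Ψ)
    (hL₁ : ∀ xh : π.absStates, LipschitzWith I₁ fun x => phi1 S π q Ψ x xh)
    (hL₂ : ∀ (xh : π.absStates) (ν : S.U), LipschitzWith I₂ fun x => phi2 S π q g Ψ x xh ν)
    {μ : ℝ} (hμ : μ + ε ≤ 0) (hviol : P {x | μ < maxPhi S π q g Ψ x} < e) :
    IsABF S π (candV S π q Ψ.eta) := by
  have hnear : ∀ x : S.X, ∃ y ∈ Metric.closedBall x (ε / max (I₁ : ℝ) I₂),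
      maxPhi S π q g Ψ y ≤ μ := by
    intro x
    by_contra hcon
    push Not at hcon
    exact not_lt.2 ((hP x).trans (measure_mono fun y hy => hcon y hy)) hviol
  refine isABF_of_phi_nonpos S π q hg hΨ.2.1 hΨ.2.2 (fun x xh => ?_) fun x xh ν => ?_
  · obtain ⟨y, hy, hy'⟩ := hnear x
    have h := (max_le_iff.1 ((maxPhi_le_iff S π q).1 hy' xh (Classical.arbitrary _))).1
    exact ((hL₁ xh).le_add_of_mem_closedBall hy (mul_div_max_le I₁.2 hε) h).trans hμ
  · obtain ⟨y, hy, hy'⟩ := hnear x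
    have h := (max_le_iff.1 ((maxPhi_le_iff S π q).1 hy' xh ν)).2
    refine ((hL₂ xh ν).le_add_of_mem_closedBall hy ?_ h).trans hμ
    rw [max_comm]
    exact mul_div_max_le I₂.2 hε

/-- Without inputs the sampled constraints are vacuous and `μ` is unbounded below. -/
theorem nonempty_inputs_of_optimal {γt : Fin l → ℝ} {N : ℕ} {ω : Fin N → S.X} {k : Fin l}
    {Ψ : Param z} {μ : ℝ} (h : SOPOptimal S π q Θ γt ω k Ψ μ) : Nonempty S.U := by
  by_contra hcon
  rw [not_nonempty_iff] at hcon
  have := h.2 k Ψ (μ - 1) ⟨h.1.1, fun _ _ ν => (hcon.false ν).elim⟩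
  linarith

/-- The probability that the scenario program returns a solution with index `k` that is negative
enough, but does not define an alternating bisimulation function. -/
theorem measure_returns_not_isABF_le (hΘc : IsClosed Θ) (hΘ : Convex ℝ Θ)
    (γt : Fin l → ℝ) (τ : Param z → ℝ) (hτ : ConvexOn ℝ Set.univ τ) (k : Fin l)
    (hγ : 0 < γt k ∧ γt k < 1) {I₁ I₂ : ℝ≥0}
    (hL₁ : ∀ Ψ, Admissible Θ Ψ → ∀ xh : π.absStates,
      LipschitzWith I₁ fun x => phi1 S π q Ψ x xh)
    (hL₂ : ∀ Ψ, Admissible Θ Ψ → ∀ (xh : π.absStates) (ν : S.U),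
      LipschitzWith I₂ fun x => phi2 S π q (γt k) Ψ x xh ν)
    {ε e : ℝ} (hε : 0 ≤ ε) (he0 : 0 ≤ e) (he1 : e ≤ 1)
    (P : Measure S.X) [IsProbabilityMeasure P]
    (hP : ∀ x : S.X, ENNReal.ofReal e ≤ P (Metric.closedBall x (ε / max (I₁ : ℝ) I₂))) (N : ℕ) :
    (Measure.pi fun _ : Fin N => P) {ω | ∃ (Ψ : Param z) (μ : ℝ),
      SOPReturns S π q Θ γt τ ω k Ψ μ ∧ μ + ε ≤ 0 ∧ ¬ IsABF S π (candV S π q Ψ.eta)} ≤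
    ENNReal.ofReal (binTail (numDecision z) N e) := by
  rcases Nat.lt_or_ge N (numDecision z) with hN | hN
  · rw [binTail_eq_one hN, ENNReal.ofReal_one]
    exact prob_le_one
  rcases he0.eq_or_lt with rfl | he0
  · rw [binTail_zero (by simp [numDecision]), ENNReal.ofReal_one]
    exact prob_le_one
  have hNpos : 0 < N := lt_of_lt_of_le (by simp [numDecision]) hN
  by_cases hU : Nonempty S.U
  swap
  · refine le_of_eq_of_le (measure_mono_null ?_ measure_empty) zero_le
    rintro ω ⟨Ψ, μ, h, -⟩
    exact hU (nonempty_inputs_of_optimal S π q h.1.1)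
  have : Nonempty S.X := P.nonempty_of_neZero
  have : Nonempty π.absStates := this.map π.quantize
  have : Nonempty (Fin N) := ⟨⟨0, hNpos⟩⟩
  have hτc : Continuous τ := continuousOn_univ.1 (hτ.continuousOn isOpen_univ)
  -- Each admissible `Ψ` lies in all large truncations, so the bad event is eventually contained in
  -- that of the compact program.
  refine measure_le_of_forall_eventually_mem _ ?_ fun R : ℕ =>
    measure_preferred_violation_le (K := Param.truncation Θ R) (f := maxPhi S π q (γt k))
      (τ := τ) (κ := Param.normSq) P (Param.isCompact_truncation hΘc R)
      (fun x => (convexOn_maxPhi S π q (γt k) x).subset (Set.subset_univ _)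
        (Param.convex_truncation hΘ R))
      (fun x => (continuous_maxPhi_param S π q (γt k) x).continuousOn)
      (fun Ψ hΨ => continuous_maxPhi_state S π q
        (fun xh => (hL₁ Ψ (Param.admissible_of_mem_truncation hΨ) xh).continuous)
        fun xh ν => (hL₂ Ψ (Param.admissible_of_mem_truncation hΨ) xh ν).continuous)
      (hτ.subset (Set.subset_univ _) (Param.convex_truncation hΘ R)) hτc.continuousOn
      (Param.strictConvexOn_normSq.subset (Set.subset_univ _) (Param.convex_truncation hΘ R))
      Param.continuous_normSq.continuousOn
      (by rw [Param.finrank_eq]; rfl) hN he0 he1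
  rintro ω ⟨Ψ₀, μ, ⟨⟨hopt, hpref⟩, hret⟩, hμ, hnot⟩
  filter_upwards [Param.eventually_mem_truncation hopt.1.1] with R hR
  refine ⟨Ψ₀, hR, μ, fun i => (maxPhi_le_iff S π q).2 (hopt.1.2 i), fun Ψ hΨ => ?_,
    fun Ψ hΨ hfeas hle => ?_⟩
  · obtain ⟨i, -, hi⟩ := Finset.exists_max_image Finset.univ
      (fun i => maxPhi S π q (γt k) Ψ (ω i)) Finset.univ_nonempty
    exact ⟨i, hopt.2 k Ψ _ ⟨Param.admissible_of_mem_truncation hΨ,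
      fun j => (maxPhi_le_iff S π q).1 (hi j (Finset.mem_univ j))⟩⟩
  -- A preferred solution with small violation would define an ABF, and the returned solution
  -- determines the same function.
  · by_contra hcon
    have hadm := Param.admissible_of_mem_truncation hΨ
    have hopt' : SOPOptimal S π q Θ γt ω k Ψ μ :=
      ⟨⟨hadm, fun i => (maxPhi_le_iff S π q).1 (hfeas i)⟩, hopt.2⟩
    have hABF := isABF_of_violation_lt S π q hγ hε P hP hadm (hL₁ Ψ hadm) (hL₂ Ψ hadm) hμ
      (not_le.1 hcon)
    rw [hret Ψ ⟨hopt', fun Ψ' h' => hle.trans (hpref Ψ' h')⟩] at hABF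
    exact hnot hABF

end Scenario

theorem theorem2 {n p z l : ℕ} (S : DtDCS n p) (π : StatePartition S.X)
    (q : Fin z → S.X → π.absStates → ℝ)
    (Θ : Set (Param z)) (hΘc : IsClosed Θ) (hΘ : Convex ℝ Θ)
    (γt : Fin l → ℝ) (hγ : ∀ k, 0 < γt k ∧ γt k < 1)
    (τ : Param z → ℝ) (hτ : ConvexOn ℝ Set.univ τ)
    (I1 : ℝ≥0) (I2 : Fin l → ℝ≥0)
    (hL1 : ∀ Ψ, Admissible Θ Ψ → ∀ xh : π.absStates,
      LipschitzWith I1 (fun x => phi1 S π q Ψ x xh))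
    (hL2 : ∀ k, ∀ Ψ, Admissible Θ Ψ → ∀ (xh : π.absStates) (ν : S.U),
      LipschitzWith (I2 k) (fun x => phi2 S π q (γt k) Ψ x xh ν))
    (ε : Fin l → ℝ) (hε0 : ∀ k, 0 ≤ ε k) (hε1 : ∀ k, ε k ≤ 1)
    (hεI : ∀ k, ε k ≤ max (I1 : ℝ) (I2 k))
    (εbar : Fin l → ℝ) (hεbar : ∀ k, εbar k = (ε k / max (I1 : ℝ) (I2 k)) ^ n)
    (P : Measure S.X) [IsProbabilityMeasure P]
    (hP : ∀ (k : Fin l) (x : S.X),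
      ENNReal.ofReal (εbar k) ≤ P (Metric.closedBall x (ε k / max (I1 : ℝ) (I2 k))))
    (β : ℝ) (hβ0 : 0 ≤ β) (hβ1 : β ≤ 1)
    (Nbar : ℕ) (hNbar : IsLeast {M : ℕ | confSum (numDecision z) εbar M ≤ β} Nbar)
    (N : ℕ) (hN : Nbar ≤ N) :
    ∃ G : Set (Fin N → S.X), MeasurableSet G ∧
      ENNReal.ofReal (1 - β) ≤ Measure.pi (fun _ : Fin N => P) G ∧
      ∀ ω ∈ G, ∀ (k : Fin l) (Ψ : Param z) (μ : ℝ),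
        SOPReturns S π q Θ γt τ ω k Ψ μ →
        μ + (⨆ k', ε k') ≤ 0 →
        IsABF S π (candV S π q Ψ.eta) := by
  have hmax : ∀ k, 0 ≤ max (I1 : ℝ) (I2 k) := fun k => le_max_of_le_left I1.2
  have he0 : ∀ k, 0 ≤ εbar k := fun k => by
    rw [hεbar]
    exact pow_nonneg (div_nonneg (hε0 k) (hmax k)) n
  have he1 : ∀ k, εbar k ≤ 1 := fun k => by
    rw [hεbar]
    exact pow_le_one₀ (div_nonneg (hε0 k) (hmax k)) (div_le_one_of_le₀ (hεI k) (hmax k))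
  let bad : Fin l → Set (Fin N → S.X) := fun k => {ω | ∃ (Ψ : Param z) (μ : ℝ),
    SOPReturns S π q Θ γt τ ω k Ψ μ ∧ μ + ε k ≤ 0 ∧ ¬ IsABF S π (candV S π q Ψ.eta)}
  have hbad : (Measure.pi fun _ : Fin N => P) (⋃ k, bad k) ≤ ENNReal.ofReal β := by
    refine (measure_iUnion_le _).trans ?_
    rw [tsum_fintype]
    calc ∑ k, (Measure.pi fun _ : Fin N => P) (bad k)
        ≤ ∑ k, ENNReal.ofReal (binTail (numDecision z) N (εbar k)) :=
          Finset.sum_le_sum fun k _ => measure_returns_not_isABF_le S π q hΘc hΘ γt τ hτ k (hγ k)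
            hL1 (hL2 k) (hε0 k) (he0 k) (he1 k) P (hP k) N
      _ = ENNReal.ofReal (∑ k, binTail (numDecision z) N (εbar k)) :=
          (ENNReal.ofReal_sum_of_nonneg fun k _ => binTail_nonneg _ _ (he0 k) (he1 k)).symm
      _ ≤ ENNReal.ofReal β := by
          refine ENNReal.ofReal_le_ofReal (le_trans ?_ hNbar.1)
          exact Finset.sum_le_sum fun k _ => binTail_antitone _ (he0 k) (he1 k) hN
  -- The bad event need not be measurable, so the complement of its measurable hull is taken.
  refine ⟨(toMeasurable (Measure.pi fun _ : Fin N => P) (⋃ k, bad k))ᶜ,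
    (measurableSet_toMeasurable _ _).compl, ?_, ?_⟩
  · rw [prob_compl_eq_one_sub (measurableSet_toMeasurable _ _), measure_toMeasurable,
      ENNReal.ofReal_sub _ hβ0, ENNReal.ofReal_one]
    exact tsub_le_tsub_left hbad 1
  · intro ω hω k Ψ μ hret hμ
    by_contra hnot
    refine hω (subset_toMeasurable _ _ (Set.mem_iUnion.2 ⟨k, Ψ, μ, hret, ?_, hnot⟩))
    have := le_ciSup (Set.finite_range ε).bddAbove k
    linarith
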